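/- Work in homotopy type theory: intensional dependent type theory with a cumulative hierarchy of universes $\mathcal U_0, \mathcal U_1, \dots$, dependent function types, dependent pair types, identity types, univalence and higher inductive types, where a statement is a type and it holds if this type is inhabited. For types $A$ and $B$ with base points $\star_A : A$ and $\star_B : B$, let - $A * B$ be the join, i.e. the (homotopy) pushout of the projections $A \leftarrow A \times B \to B$, with constructors $\mathrm{inl} : A \to A*B$, $\mathrm{inr} : B \to A*B$ and $\mathrm{push}(a,b) : \mathrm{inl}(a) = \mathrm{inr}(b)$; - $A \wedge B$ be the smash product, i.e. the higher inductive type with constructors $\star_\wedge : A \wedge B$, $\langle -,-\rangle : A \times B \to A \wedge B$, $\mathrm{push}_l(a) : \langle a, \star_B\rangle = \star_\wedge$ for $a : A$, $\mathrm{push}_r(b) : \langle \star_A, b\rangle = \star_\wedge$ for $b : B$, and $\mathrm{push}_{lr} : \mathrm{push}_l(\star_A) = \mathrm{push}_r(\star_B)$; - $\mathrm{Susp}(C)$ be the suspension of a type $C$, with constructors $\mathrm{north}, \mathrm{south} : \mathrm{Susp}(C)$ and $\mathrm{merid}(c) : \mathrm{north} = \mathrm{south}$ for $c : C$. Let $\mathrm{pinch}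 : A * B \to \mathrm{Susp}(A \wedge B)$ be the map defined by pushout recursion with $\mathrm{pinch}(\mathrm{inl}(a)) = \mathrm{north}$, $\mathrm{pinch}(\mathrm{inr}(b)) = \mathrm{south}$, and sending the path $\mathrm{push}(a,b)$ to the path $\mathrm{merid}\langle a,b\rangle$. Then, for all pointed types $(A,\star_A)$ and $(B,\star_B)$, the map $\mathrm{pinch}$ is an equivalence, i.e. for every $y : \mathrm{Susp}(A\wedge B)$ the homotopy fibre $\sum_{x : A*B} (\mathrm{pinch}(x) = y)$ is contractible. -/

import Mathlib

/-!
Homotopy type theory as a formal system: dependent type theory with a cumulative hierarchy of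
universes, dependent function and pair types, intensional identity types, univalence, and the
higher inductive types "pushout", "suspension" and "smash product".  A statement of homotopy type
theory is a closed type of this system, and it holds when some closed term has that type.

The system is a fragment of Book HoTT: no type former beyond those listed is included (such as the
natural numbers or truncations), nor is the eta rule for functions.  Every derivation in it is
therefore a derivation in the full theory.
-/

namespace HoTT

/-! ### Terms -/

/-- The primitive constants; the numbers are universe levels.  Their types are given by `constType`
below. -/
inductive Const : Type
  -- dependent pairs
  | sig (i : ℕ) | pair (i : ℕ) | sigInd (i j : ℕ)
  -- identity types
  | idt (i : ℕ) | refl (i : ℕ) | J (i j : ℕ)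
  -- homotopy pushouts
  | pushout (i : ℕ) | inl (i : ℕ) | inr (i : ℕ) | push (i : ℕ)
  | pushoutInd (i j : ℕ) | pushoutBeta (i j : ℕ)
  -- suspensions
  | susp (i : ℕ) | north (i : ℕ) | south (i : ℕ) | merid (i : ℕ)
  | suspInd (i j : ℕ) | suspBeta (i j : ℕ)
  -- smash products
  | smash (i : ℕ) | smashPt (i : ℕ) | smashMk (i : ℕ)
  | smashL (i : ℕ) | smashR (i : ℕ) | smashLR (i : ℕ)
  | smashInd (i j : ℕ) | smashBetaL (i j : ℕ) | smashBetaR (i j : ℕ) | smashBetaLR (i j : ℕ)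
  -- univalence
  | univalence (i : ℕ)

/-- Raw terms, with de Bruijn indices: `pi A B` and `lam A b` bind the variable `0` in `B`, `b`. -/
inductive Tm : Type
  | var (n : ℕ)
  | univ (i : ℕ)
  | pi (A B : Tm)
  | lam (A b : Tm)
  | app (f a : Tm)
  | const (c : Const)

namespace Tm

/-- Lift a renaming under a binder. -/
def liftRen (r : ℕ → ℕ) : ℕ → ℕ
  | 0 => 0
  | n + 1 => r n + 1

/-- Renaming of variables. -/
def rename : (ℕ → ℕ) → Tm → Tm
  | r, var n => var (r n)
  | _, univ i => univ i
  | r, pi A B => pi (rename r A) (rename (liftRen r) B)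
  | r, lam A b => lam (rename r A) (rename (liftRen r) b)
  | r, app f a => app (rename r f) (rename r a)
  | _, const c => const c

/-- Lift a substitution under a binder. -/
def liftSub (s : ℕ → Tm) : ℕ → Tm
  | 0 => var 0
  | n + 1 => rename Nat.succ (s n)

/-- Simultaneous capture-avoiding substitution. -/
def subst : (ℕ → Tm) → Tm → Tm
  | s, var n => s n
  | _, univ i => univ i
  | s, pi A B => pi (subst s A) (subst (liftSub s) B)
  | s, lam A b => lam (subst s A) (subst (liftSub s) b)
  | s, app f a => app (subst s f) (subst s a)
  | _, const c => const c

/-- The substitution that replaces the variable `0` by `a` and lowers the other ones. -/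
def single (a : Tm) : ℕ → Tm
  | 0 => a
  | n + 1 => var n

/-- `inst b a` is `b[a/0]`. -/
def inst (b a : Tm) : Tm := subst (single a) b

/-- A constant applied to a list of arguments. -/
def capp (c : Const) (l : List Tm) : Tm := l.foldl app (const c)

end Tm

/-! ### Definitional equality -/

open Tm in
/-- Definitional equality: the congruence generated by beta reduction and by the computation rules
of the eliminators on point constructors. (Conversion is used only between types that are both
well-formed, see `HasType.conv`.) -/
inductive Conv : Tm → Tm → Prop
  | rfl (t) : Conv t t
  | symm {t u} : Conv t u → Conv u t
  | trans {t u v} : Conv t u → Conv u v → Conv t v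
  | pi {A A' B B'} : Conv A A' → Conv B B' → Conv (pi A B) (pi A' B')
  | lam {A A' b b'} : Conv A A' → Conv b b' → Conv (lam A b) (lam A' b')
  | app {f f' a a'} : Conv f f' → Conv a a' → Conv (app f a) (app f' a')
  | beta (A b a) : Conv (app (lam A b) a) (inst b a)
  -- the eliminator of pairs, on `(a, b)`
  | sigInd (i j i' A B C g A' B' a b) :
      Conv (capp (.sigInd i j) [A, B, C, g, capp (.pair i') [A', B', a, b]]) (app (app g a) b)
  -- path induction, on `refl`
  | J (i j i' A x C d y A' x') :
      Conv (capp (.J i j) [A, x, C, d, y, capp (.refl i') [A', x']]) d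
  -- the eliminator of pushouts, on `inl b` and on `inr c`
  | pushoutInl (i j i' A B C f g P l r m A' B' C' f' g' b) :
      Conv (capp (.pushoutInd i j)
        [A, B, C, f, g, P, l, r, m, capp (.inl i') [A', B', C', f', g', b]]) (app l b)
  | pushoutInr (i j i' A B C f g P l r m A' B' C' f' g' c) :
      Conv (capp (.pushoutInd i j)
        [A, B, C, f, g, P, l, r, m, capp (.inr i') [A', B', C', f', g', c]]) (app r c)
  -- the eliminator of suspensions, on `north` and on `south`
  | suspNorth (i j i' A P n s m A') :
      Conv (capp (.suspInd i j) [A, P, n, s, m, capp (.north i') [A']]) n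
  | suspSouth (i j i' A P n s m A') :
      Conv (capp (.suspInd i j) [A, P, n, s, m, capp (.south i') [A']]) s
  -- the eliminator of smash products, on the base point and on `⟨p⟩`
  | smashPt (i j i' A a B b P z k l r m A' a' B' b') :
      Conv (capp (.smashInd i j)
        [A, a, B, b, P, z, k, l, r, m, capp (.smashPt i') [A', a', B', b']]) z
  | smashMk (i j i' A a B b P z k l r m A' a' B' b' p) :
      Conv (capp (.smashInd i j)
        [A, a, B, b, P, z, k, l, r, m, capp (.smashMk i') [A', a', B', b', p]]) (app k p)

/-! ### Named notation for terms

An `Exp` is a term that may be placed under any number `d` of binders.  It lets us write binders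
through Lean functions, `lam A fun x => ...`, and write application as juxtaposition. -/

/-- A term as a function of the number of binders above it. -/
structure Exp : Type where
  toTm : ℕ → Tm

namespace Exp

def app (f a : Exp) : Exp := ⟨fun d => .app (f.toTm d) (a.toTm d)⟩

instance : CoeFun Exp fun _ => Exp → Exp := ⟨app⟩

/-- The variable bound by the binder that has exactly `l` binders above it. -/
def level (l : ℕ) : Exp := ⟨fun d => .var (d - (l + 1))⟩

/-- The closed term denoted by an expression. -/
def close (e : Exp) : Tm := e.toTm 0

end Exp

def U (i : ℕ) : Exp := ⟨fun _ => .univ i⟩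

def pi (A : Exp) (B : Exp → Exp) : Exp :=
  ⟨fun d => .pi (A.toTm d) ((B (.level d)).toTm (d + 1))⟩

def lam (A : Exp) (b : Exp → Exp) : Exp :=
  ⟨fun d => .lam (A.toTm d) ((b (.level d)).toTm (d + 1))⟩

def cst (c : Const) : Exp := ⟨fun _ => .const c⟩

/-- The type of functions `A → B`. -/
def arr (A B : Exp) : Exp := pi A fun _ => B

/-! ### Dependent pairs -/

/-- `Σ x : A, B x`. -/
def sig (i : ℕ) (A : Exp) (B : Exp → Exp) : Exp := cst (.sig i) A (lam A B)

/-- The pair `(a, b)` of type `Σ x : A, B x`. -/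
def pair (i : ℕ) (A : Exp) (B : Exp → Exp) (a b : Exp) : Exp := cst (.pair i) A (lam A B) a b

/-- `A × B`. -/
def prod (i : ℕ) (A B : Exp) : Exp := sig i A fun _ => B

/-- `(a, b) : A × B`. -/
def mk (i : ℕ) (A B a b : Exp) : Exp := pair i A (fun _ => B) a b

/-- The projection `A × B → A`. -/
def fst (i : ℕ) (A B : Exp) : Exp :=
  cst (.sigInd i i) A (lam A fun _ => B) (lam (prod i A B) fun _ => A)
    (lam A fun a => lam B fun _ => a)

/-- The projection `A × B → B`. -/
def snd (i : ℕ) (A B : Exp) : Exp :=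
  cst (.sigInd i i) A (lam A fun _ => B) (lam (prod i A B) fun _ => B)
    (lam A fun _ => lam B fun b => b)

/-! ### Paths.  Levels: `A : U i`, and `P : A → U j`. -/

/-- The identity type `x = y` in `A`. -/
def idt (i : ℕ) (A x y : Exp) : Exp := cst (.idt i) A x y

/-- `refl : x = x`. -/
def refl (i : ℕ) (A x : Exp) : Exp := cst (.refl i) A x

/-- Transport `P x → P y` along `p : x = y`. -/
def transport (i j : ℕ) (A P x y p : Exp) : Exp :=
  cst (.J i j) A x (lam A fun z => lam (idt i A x z) fun _ => arr (P x) (P z))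
    (lam (P x) fun u => u) y p

/-- Dependent paths from `u : P x` to `v : P y` over `p : x = y`. -/
def pathOver (i j : ℕ) (A P x y p u v : Exp) : Exp := idt j (P y) (transport i j A P x y p u) v

/-- The dependent path `f x = f y` over `p : x = y`, for `f : Π x, P x`. -/
def apd (i j : ℕ) (A P f x y p : Exp) : Exp :=
  cst (.J i j) A x
    (lam A fun z => lam (idt i A x z) fun q => pathOver i j A P x z q (f x) (f z))
    (refl j (P x) (f x)) y p

/-- The path `f x = f y` in `B`, for `f : A → B` and `p : x = y`. -/
def ap (i j : ℕ) (A B f x y p : Exp) : Exp :=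
  cst (.J i j) A x (lam A fun z => lam (idt i A x z) fun _ => idt j B (f x) (f z))
    (refl j B (f x)) y p

/-- Composition of `p : x = y` and `q : y = z`. -/
def concat (i : ℕ) (A x y z p q : Exp) : Exp :=
  cst (.J i i) A y (lam A fun w => lam (idt i A y w) fun _ => idt i A x w) p z q

/-- For `p : x = y` in `A` and `q : u = v` in `B`, the dependent path from `u` to `v` over `p` in
the constant family `B`. -/
def constOver (i j : ℕ) (A B x y p u v q : Exp) : Exp :=
  concat j B (transport i j A (lam A fun _ => B) x y p u) u v
    (cst (.J i j) A x
      (lam A fun z => lam (idt i A x z) fun r =>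
        idt j B (transport i j A (lam A fun _ => B) x z r u) u)
      (refl j B u) y p)
    q

/-! ### Equivalences -/

/-- `A` is contractible. -/
def isContr (i : ℕ) (A : Exp) : Exp := sig i A fun c => pi A fun x => idt i A c x

/-- The homotopy fibre of `f : A → B` over `y`. -/
def fib (i : ℕ) (A B f y : Exp) : Exp := sig i A fun x => idt i B (f x) y

/-- `f : A → B` is an equivalence. -/
def isEquiv (i : ℕ) (A B f : Exp) : Exp := pi B fun y => isContr i (fib i A B f y)

/-- The type of equivalences between `A` and `B`. -/
def equiv (i : ℕ) (A B : Exp) : Exp := sig i (arr A B) fun f => isEquiv i A B f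

/-- The identity function of `A`. -/
def idFun (A : Exp) : Exp := lam A fun x => x

/-- The identity function of `A` is an equivalence. -/
def idIsEquiv (i : ℕ) (A : Exp) : Exp :=
  let F (y : Exp) : Exp := fib i A A (idFun A) y
  let el (y x p : Exp) : Exp := pair i A (fun x => idt i A (idFun A x) y) x p
  lam A fun y => pair i (F y) (fun c => pi (F y) fun w => idt i (F y) c w)
    (el y y (refl i A y))
    (cst (.sigInd i i) A (lam A fun x => idt i A (idFun A x) y)
      (lam (F y) fun w => idt i (F y) (el y y (refl i A y)) w)
      (lam A fun x => lam (idt i A (idFun A x) y) fun p =>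
        cst (.J i i) A x
          (lam A fun z => lam (idt i A x z) fun q =>
            idt i (F z) (el z z (refl i A z)) (el z x q))
          (refl i (F x) (el x x (refl i A x))) y p))

/-- The canonical map `A = B → A ≃ B`, defined by path induction, for `A B : U i`. -/
def idToEquiv (i : ℕ) (A B : Exp) : Exp :=
  lam (idt (i + 1) (U i) A B) fun p =>
    cst (.J (i + 1) i) (U i) A (lam (U i) fun X => lam (idt (i + 1) (U i) A X) fun _ => equiv i A X)
      (pair i (arr A A) (fun f => isEquiv i A A f) (idFun A) (idIsEquiv i A)) B p

/-! ### Pushouts -/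

/-- The pushout of a span `f : A → B`, `g : A → C`. -/
def pushout (i : ℕ) (A B C f g : Exp) : Exp := cst (.pushout i) A B C f g
def inl (i : ℕ) (A B C f g b : Exp) : Exp := cst (.inl i) A B C f g b
def inr (i : ℕ) (A B C f g c : Exp) : Exp := cst (.inr i) A B C f g c

/-- The path `inl (f a) = inr (g a)`. -/
def push (i : ℕ) (A B C f g a : Exp) : Exp := cst (.push i) A B C f g a

/-- The type of dependent paths over `push a`, in a family `P`, from `l (f a)` to `r (g a)`. -/
def pushOver (i j : ℕ) (A B C f g P l r a : Exp) : Exp :=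
  pathOver i j (pushout i A B C f g) P (inl i A B C f g (f a)) (inr i A B C f g (g a))
    (push i A B C f g a) (l (f a)) (r (g a))

/-- The premises of the dependent eliminator of pushouts, in front of a conclusion `D`. -/
def pushoutElim (i j : ℕ) (D : Exp → Exp → Exp → Exp → Exp → Exp → Exp → Exp → Exp → Exp) : Exp :=
  pi (U i) fun A => pi (U i) fun B => pi (U i) fun C => pi (arr A B) fun f => pi (arr A C) fun g =>
  pi (arr (pushout i A B C f g) (U j)) fun P =>
  pi (pi B fun b => P (inl i A B C f g b)) fun l =>
  pi (pi C fun c => P (inr i A B C f g c)) fun r =>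
  pi (pi A fun a => pushOver i j A B C f g P l r a) fun m =>
  D A B C f g P l r m

/-! ### Suspensions -/

def susp (i : ℕ) (A : Exp) : Exp := cst (.susp i) A
def north (i : ℕ) (A : Exp) : Exp := cst (.north i) A
def south (i : ℕ) (A : Exp) : Exp := cst (.south i) A

/-- The path `north = south` given by `a : A`. -/
def merid (i : ℕ) (A a : Exp) : Exp := cst (.merid i) A a

/-- The type of dependent paths over `merid a`, in a family `P`, from `n` to `s`. -/
def meridOver (i j : ℕ) (A P n s a : Exp) : Exp :=
  pathOver i j (susp i A) P (north i A) (south i A) (merid i A a) n s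

/-- The premises of the dependent eliminator of suspensions, in front of a conclusion `D`. -/
def suspElim (i j : ℕ) (D : Exp → Exp → Exp → Exp → Exp → Exp) : Exp :=
  pi (U i) fun A => pi (arr (susp i A) (U j)) fun P =>
  pi (P (north i A)) fun n => pi (P (south i A)) fun s =>
  pi (pi A fun a => meridOver i j A P n s a) fun m =>
  D A P n s m

/-! ### Smash products of pointed types `(A, a)` and `(B, b)` -/

def smash (i : ℕ) (A a B b : Exp) : Exp := cst (.smash i) A a B b

/-- The base point of the smash product. -/
def smashPt (i : ℕ) (A a B b : Exp) : Exp := cst (.smashPt i) A a B b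

/-- The point `⟨p⟩` of the smash product given by `p : A × B`. -/
def smashMk (i : ℕ) (A a B b p : Exp) : Exp := cst (.smashMk i) A a B b p

/-- The path from `⟨x, b⟩` to the base point. -/
def smashL (i : ℕ) (A a B b x : Exp) : Exp := cst (.smashL i) A a B b x

/-- The path from `⟨a, y⟩` to the base point. -/
def smashR (i : ℕ) (A a B b y : Exp) : Exp := cst (.smashR i) A a B b y

/-- The two-dimensional path `smashL a = smashR b`. -/
def smashLR (i : ℕ) (A a B b : Exp) : Exp := cst (.smashLR i) A a B b

/-- Dependent paths over a path `q : ⟨p⟩ = smashPt`, in a family `P`, from `k p` to `z`. -/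
def smashOver (i j : ℕ) (A a B b P z k p q : Exp) : Exp :=
  pathOver i j (smash i A a B b) P (smashMk i A a B b p) (smashPt i A a B b) q (k p) z

/-- The type of the paths from `⟨a, b⟩` to the base point. -/
def smashLoop (i : ℕ) (A a B b : Exp) : Exp :=
  idt i (smash i A a B b) (smashMk i A a B b (mk i A B a b)) (smashPt i A a B b)

/-- The family of the dependent paths from `k (a, b)` to `z` over the paths from `⟨a, b⟩` to the
base point. -/
def smashFam (i j : ℕ) (A a B b P z k : Exp) : Exp :=
  lam (smashLoop i A a B b) fun q => smashOver i j A a B b P z k (mk i A B a b) q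

/-- The premises of the dependent eliminator of smash products, in front of a conclusion `D`. -/
def smashElim (i j : ℕ)
    (D : Exp → Exp → Exp → Exp → Exp → Exp → Exp → Exp → Exp → Exp → Exp) : Exp :=
  pi (U i) fun A => pi A fun a => pi (U i) fun B => pi B fun b =>
  pi (arr (smash i A a B b) (U j)) fun P =>
  pi (P (smashPt i A a B b)) fun z =>
  pi (pi (prod i A B) fun p => P (smashMk i A a B b p)) fun k =>
  pi (pi A fun x => smashOver i j A a B b P z k (mk i A B x b) (smashL i A a B b x)) fun l =>
  pi (pi B fun y => smashOver i j A a B b P z k (mk i A B a y) (smashR i A a B b y)) fun r =>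
  pi (pathOver i j (smashLoop i A a B b) (smashFam i j A a B b P z k)
    (smashL i A a B b a) (smashR i A a B b b) (smashLR i A a B b) (l a) (r b)) fun m =>
  D A a B b P z k l r m

/-! ### The types of the constants -/

/-- The type of each constant, as a closed term. -/
def constType : Const → Tm
  | .sig i => Exp.close <| pi (U i) fun A => arr (arr A (U i)) (U i)
  | .pair i => Exp.close <| pi (U i) fun A => pi (arr A (U i)) fun B =>
      pi A fun a => arr (B a) (cst (.sig i) A B)
  | .sigInd i j => Exp.close <| pi (U i) fun A => pi (arr A (U i)) fun B =>
      pi (arr (cst (.sig i) A B) (U j)) fun P =>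
      pi (pi A fun a => pi (B a) fun b => P (cst (.pair i) A B a b)) fun _ =>
      pi (cst (.sig i) A B) fun p => P p
  | .idt i => Exp.close <| pi (U i) fun A => arr A (arr A (U i))
  | .refl i => Exp.close <| pi (U i) fun A => pi A fun x => idt i A x x
  -- based path induction
  | .J i j => Exp.close <| pi (U i) fun A => pi A fun x =>
      pi (pi A fun y => arr (idt i A x y) (U j)) fun P =>
      pi (P x (refl i A x)) fun _ => pi A fun y => pi (idt i A x y) fun p => P y p
  | .pushout i => Exp.close <| pi (U i) fun A => pi (U i) fun B => pi (U i) fun C =>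
      arr (arr A B) (arr (arr A C) (U i))
  | .inl i => Exp.close <| pi (U i) fun A => pi (U i) fun B => pi (U i) fun C =>
      pi (arr A B) fun f => pi (arr A C) fun g => arr B (pushout i A B C f g)
  | .inr i => Exp.close <| pi (U i) fun A => pi (U i) fun B => pi (U i) fun C =>
      pi (arr A B) fun f => pi (arr A C) fun g => arr C (pushout i A B C f g)
  | .push i => Exp.close <| pi (U i) fun A => pi (U i) fun B => pi (U i) fun C =>
      pi (arr A B) fun f => pi (arr A C) fun g => pi A fun a =>
      idt i (pushout i A B C f g) (inl i A B C f g (f a)) (inr i A B C f g (g a))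
  | .pushoutInd i j => Exp.close <| pushoutElim i j fun A B C f g P _ _ _ =>
      pi (pushout i A B C f g) fun x => P x
  -- the eliminator sends `push a` to `m a`
  | .pushoutBeta i j => Exp.close <| pushoutElim i j fun A B C f g P l r m => pi A fun a =>
      idt j (pushOver i j A B C f g P l r a)
        (apd i j (pushout i A B C f g) P (cst (.pushoutInd i j) A B C f g P l r m)
          (inl i A B C f g (f a)) (inr i A B C f g (g a)) (push i A B C f g a))
        (m a)
  | .susp i => Exp.close <| arr (U i) (U i)
  | .north i => Exp.close <| pi (U i) fun A => susp i A
  | .south i => Exp.close <| pi (U i) fun A => susp i A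
  | .merid i => Exp.close <| pi (U i) fun A => arr A (idt i (susp i A) (north i A) (south i A))
  | .suspInd i j => Exp.close <| suspElim i j fun A P _ _ _ => pi (susp i A) fun x => P x
  -- the eliminator sends `merid a` to `m a`
  | .suspBeta i j => Exp.close <| suspElim i j fun A P n s m => pi A fun a =>
      idt j (meridOver i j A P n s a)
        (apd i j (susp i A) P (cst (.suspInd i j) A P n s m)
          (north i A) (south i A) (merid i A a))
        (m a)
  | .smash i => Exp.close <| pi (U i) fun A => pi A fun _ => pi (U i) fun B => pi B fun _ => U i
  | .smashPt i => Exp.close <| pi (U i) fun A => pi A fun a => pi (U i) fun B => pi B fun b =>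
      smash i A a B b
  | .smashMk i => Exp.close <| pi (U i) fun A => pi A fun a => pi (U i) fun B => pi B fun b =>
      arr (prod i A B) (smash i A a B b)
  | .smashL i => Exp.close <| pi (U i) fun A => pi A fun a => pi (U i) fun B => pi B fun b =>
      pi A fun x =>
      idt i (smash i A a B b) (smashMk i A a B b (mk i A B x b)) (smashPt i A a B b)
  | .smashR i => Exp.close <| pi (U i) fun A => pi A fun a => pi (U i) fun B => pi B fun b =>
      pi B fun y =>
      idt i (smash i A a B b) (smashMk i A a B b (mk i A B a y)) (smashPt i A a B b)
  | .smashLR i => Exp.close <| pi (U i) fun A => pi A fun a => pi (U i) fun B => pi B fun b =>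
      idt i (smashLoop i A a B b) (smashL i A a B b a) (smashR i A a B b b)
  | .smashInd i j => Exp.close <| smashElim i j fun A a B b P _ _ _ _ _ =>
      pi (smash i A a B b) fun x => P x
  -- the eliminator sends `smashL x` to `l x`
  | .smashBetaL i j => Exp.close <| smashElim i j fun A a B b P z k l r m => pi A fun x =>
      idt j (smashOver i j A a B b P z k (mk i A B x b) (smashL i A a B b x))
        (apd i j (smash i A a B b) P (cst (.smashInd i j) A a B b P z k l r m)
          (smashMk i A a B b (mk i A B x b)) (smashPt i A a B b) (smashL i A a B b x))
        (l x)
  -- the eliminator sends `smashR y` to `r y`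
  | .smashBetaR i j => Exp.close <| smashElim i j fun A a B b P z k l r m => pi B fun y =>
      idt j (smashOver i j A a B b P z k (mk i A B a y) (smashR i A a B b y))
        (apd i j (smash i A a B b) P (cst (.smashInd i j) A a B b P z k l r m)
          (smashMk i A a B b (mk i A B a y)) (smashPt i A a B b) (smashR i A a B b y))
        (r y)
  -- the eliminator sends `smashLR` to `m`, up to the two preceding identifications: with
  -- `T` the transport along `smashLR`, the two sides are paths from `T (apd f (smashL a))` to `r b`
  | .smashBetaLR i j => Exp.close <| smashElim i j fun A a B b P z k l r m =>
      let x := smashMk i A a B b (mk i A B a b)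
      let y := smashPt i A a B b
      let f := cst (.smashInd i j) A a B b P z k l r m
      let apf (q : Exp) : Exp := apd i j (smash i A a B b) P f x y q
      let Q := smashFam i j A a B b P z k
      let pl := smashL i A a B b a
      let pr := smashR i A a B b b
      let T := transport i j (smashLoop i A a B b) Q pl pr (smashLR i A a B b)
      let betaL := cst (.smashBetaL i j) A a B b P z k l r m a
      let betaR := cst (.smashBetaR i j) A a B b P z k l r m b
      idt j (idt j (Q pr) (T (apf pl)) (r b))
        (concat j (Q pr) (T (apf pl)) (apf pr) (r b)
          (apd i j (smashLoop i A a B b) Q (lam (smashLoop i A a B b) fun q => apf q)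
            pl pr (smashLR i A a B b))
          betaR)
        (concat j (Q pr) (T (apf pl)) (T (l a)) (r b)
          (ap j j (Q pl) (Q pr) T (apf pl) (l a) betaL)
          m)
  -- the canonical map `A = B → A ≃ B` is an equivalence
  | .univalence i => Exp.close <| pi (U i) fun A => pi (U i) fun B =>
      isEquiv (i + 1) (idt (i + 1) (U i) A B) (equiv i A B) (idToEquiv i A B)

/-! ### Typing -/

/-- `HasType Γ t A`: in the context `Γ` (its head is the type of the variable `0`), the term `t` has
type `A`. A context is extended only by well-formed types, so starting from the empty context all
contexts of a derivation are well-formed. -/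
inductive HasType : List Tm → Tm → Tm → Prop
  | var {Γ n A} : Γ[n]? = some A → HasType Γ (.var n) (A.rename (· + (n + 1)))
  | univ {Γ} (i) : HasType Γ (.univ i) (.univ (i + 1))
  | cumul {Γ A i} : HasType Γ A (.univ i) → HasType Γ A (.univ (i + 1))
  | pi {Γ A B i} : HasType Γ A (.univ i) → HasType (A :: Γ) B (.univ i) →
      HasType Γ (.pi A B) (.univ i)
  | lam {Γ A B b i} : HasType Γ A (.univ i) → HasType (A :: Γ) b B →
      HasType Γ (.lam A b) (.pi A B)
  | app {Γ A B f a} : HasType Γ f (.pi A B) → HasType Γ a A → HasType Γ (.app f a) (B.inst a)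
  | const {Γ} (c : Const) : HasType Γ (.const c) (constType c)
  | conv {Γ A B t i} : HasType Γ t A → Conv A B → HasType Γ B (.univ i) → HasType Γ t B

/-- The closed type denoted by `A` is inhabited: the statement `A` holds in homotopy type theory. -/
def Holds (A : Exp) : Prop := ∃ t : Tm, HasType [] t A.close

/-! ### The pinch map -/

/-- The join `A * B`: the pushout of the projections `A ← A × B → B`. -/
def join (i : ℕ) (A B : Exp) : Exp := pushout i (prod i A B) A B (fst i A B) (snd i A B)

/-- The map `pinch : A * B → Susp (A ∧ B)` that sends `inl x` to `north`, `inr y` to `south` and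
the path `push p` to `merid ⟨p⟩`. -/
def pinch (i : ℕ) (A a B b : Exp) : Exp :=
  let S := smash i A a B b
  let n := north i S
  let s := south i S
  cst (.pushoutInd i i) (prod i A B) A B (fst i A B) (snd i A B)
    (lam (join i A B) fun _ => susp i S)
    (lam A fun _ => n)
    (lam B fun _ => s)
    (lam (prod i A B) fun p =>
      constOver i i (join i A B) (susp i S)
        (inl i (prod i A B) A B (fst i A B) (snd i A B) (fst i A B p))
        (inr i (prod i A B) A B (fst i A B) (snd i A B) (snd i A B p))
        (push i (prod i A B) A B (fst i A B) (snd i A B) p)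
        n s (merid i S (smashMk i A a B b p)))

end HoTT

/-! The inverse of `pinch` sends `north` to `inl a`, `south` to `inr b`, and `merid ⟨x, y⟩` to the
detour push(a,b) · push(x,b)⁻¹ · push(x,y) · push(a,y)⁻¹ · push(a,b). If y is b or x is a, factors
cancel and push(a,b) remains; the two cancellations agree at (a,b), so the detour is defined on the
whole smash product (`smashPath`).

The composite on the join is homotopic to the identity through push(a,b) · push(x,b)⁻¹ at `inl x`
and push(a,b)⁻¹ · push(a,y) at `inr y`; over push(x,y) the end of the detour cancels (`zigzagEta`).
The homotopy for the other composite is constant at the poles, and what remains is that `pinch` maps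
the path `smashPath s` to `merid s` (`apPinchPath`). For s = ⟨x,y⟩ the image of the detour is a
zigzag of meridians; push_l and push_r identify all but the middle one with the meridian of the base
point, so the zigzag contracts to `merid ⟨x, y⟩`. This extends over push_l and push_r
(`apPinchOverL`, `apPinchOverR`). Nothing has to be verified over push_lr, because the homotopy may
be altered by a loop (`smashIndWeak`). Finally `quasiInverse` makes the fibres contractible.

`Holds` asks for a typing derivation. Derivations come from a type checker for the calculus, proved
sound in `check_sound` and run by evaluation. The argument is a list of definitions inside the
calculus, each checked in the context of the earlier ones, and such a context is realized by terms
typed in the empty context (`Ctx.Realizable.extend`). The checker computes with numerals, so it runs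
at level 0; shifting all levels of the derivation (`HasType.lift`) gives every universe. -/

namespace HoTT

/-! ### Substitution calculus -/

namespace Tm

theorem liftRen_var (r : ℕ → ℕ) : liftSub (fun n => var (r n)) = fun n => var (liftRen r n) := by
  funext n; cases n <;> rfl

theorem rename_eq_subst (r : ℕ → ℕ) (t : Tm) : rename r t = subst (fun n => var (r n)) t := by
  induction t generalizing r <;> simp_all [rename, subst, liftRen_var]

theorem liftSub_var : liftSub var = var := by
  funext n; cases n <;> rfl

theorem subst_var (t : Tm) : subst var t = t := by
  induction t <;> simp_all [subst, liftSub_var]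

theorem liftSub_comp_ren (s : ℕ → Tm) (r : ℕ → ℕ) :
    liftSub (fun n => s (r n)) = fun n => liftSub s (liftRen r n) := by
  funext n; cases n <;> rfl

theorem subst_rename (s : ℕ → Tm) (r : ℕ → ℕ) (t : Tm) :
    subst s (rename r t) = subst (fun n => s (r n)) t := by
  induction t generalizing s r <;> simp_all [rename, subst, liftSub_comp_ren]

theorem rename_rename (r' r : ℕ → ℕ) (t : Tm) :
    rename r' (rename r t) = rename (fun n => r' (r n)) t := by
  simp only [rename_eq_subst r', rename_eq_subst (fun n => r' (r n)), subst_rename]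

theorem ren_comp_liftSub (s : ℕ → Tm) (r : ℕ → ℕ) :
    liftSub (fun n => rename r (s n)) = fun n => rename (liftRen r) (liftSub s n) := by
  funext n
  cases n with
  | zero => rfl
  | succ n => simp [liftSub, rename_rename, liftRen]

theorem rename_subst (r : ℕ → ℕ) (s : ℕ → Tm) (t : Tm) :
    rename r (subst s t) = subst (fun n => rename r (s n)) t := by
  induction t generalizing s r <;> simp_all [rename, subst, ren_comp_liftSub]

theorem subst_comp_liftSub (s' s : ℕ → Tm) :
    liftSub (fun n => subst s' (s n)) = fun n => subst (liftSub s') (liftSub s n) := by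
  funext n
  cases n with
  | zero => rfl
  | succ n => simp [liftSub, subst_rename, rename_subst]

theorem subst_subst (s' s : ℕ → Tm) (t : Tm) :
    subst s' (subst s t) = subst (fun n => subst s' (s n)) t := by
  induction t generalizing s s' <;> simp_all [subst, subst_comp_liftSub]

theorem subst_inst (s : ℕ → Tm) (b a : Tm) :
    subst s (inst b a) = inst (subst (liftSub s) b) (subst s a) := by
  simp only [inst, subst_subst]
  congr 1
  funext n
  cases n with
  | zero => rfl
  | succ n => simp [single, liftSub, subst, subst_rename, subst_var]

theorem rename_inst (r : ℕ → ℕ) (b a : Tm) :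
    rename r (inst b a) = inst (rename (liftRen r) b) (rename r a) := by
  simp only [rename_eq_subst, subst_inst, liftRen_var]

theorem subst_foldl_app (s : ℕ → Tm) (h : Tm) (l : List Tm) :
    subst s (l.foldl app h) = (l.map (subst s)).foldl app (subst s h) := by
  induction l generalizing h <;> simp_all [subst]

theorem subst_capp (s : ℕ → Tm) (c : Const) (l : List Tm) :
    subst s (capp c l) = capp c (l.map (subst s)) :=
  subst_foldl_app s _ l

/-- Extension of a substitution by a value of the variable `0`. -/
def cons (a : Tm) (s : ℕ → Tm) : ℕ → Tm
  | 0 => a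
  | n + 1 => s n

theorem subst_cons_rename_succ (a : Tm) (s : ℕ → Tm) (n : ℕ) (t : Tm) :
    subst (cons a s) (rename (· + (n + 1 + 1)) t) = subst s (rename (· + (n + 1)) t) := by
  simp only [subst_rename]; rfl

theorem subst_liftSub_rename_succ (s : ℕ → Tm) (n : ℕ) (t : Tm) :
    subst (liftSub s) (rename (· + (n + 1 + 1)) t) =
      rename Nat.succ (subst s (rename (· + (n + 1)) t)) := by
  simp only [subst_rename, rename_subst]; rfl

end Tm

/-! ### Stability of the judgements under substitution -/

open Tm

/-- The computation rules are schematic in their arguments, so a substitution carries an instance of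
a rule to another instance; only beta needs `subst_inst`. -/
theorem Conv.subst {t u : Tm} (h : Conv t u) (s : ℕ → Tm) : Conv (t.subst s) (u.subst s) := by
  induction h generalizing s with
  | rfl => exact .rfl _
  | symm _ ih => exact (ih s).symm
  | trans _ _ ih₁ ih₂ => exact (ih₁ s).trans (ih₂ s)
  | pi _ _ ih₁ ih₂ => exact .pi (ih₁ s) (ih₂ _)
  | lam _ _ ih₁ ih₂ => exact .lam (ih₁ s) (ih₂ _)
  | app _ _ ih₁ ih₂ => exact .app (ih₁ s) (ih₂ s)
  | beta A b a => rw [subst_inst]; exact .beta _ _ _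
  | sigInd => simp only [subst_capp, List.map, Tm.subst]; apply Conv.sigInd
  | J => simp only [subst_capp, List.map]; apply Conv.J
  | pushoutInl => simp only [subst_capp, List.map, Tm.subst]; apply Conv.pushoutInl
  | pushoutInr => simp only [subst_capp, List.map, Tm.subst]; apply Conv.pushoutInr
  | suspNorth => simp only [subst_capp, List.map]; apply Conv.suspNorth
  | suspSouth => simp only [subst_capp, List.map]; apply Conv.suspSouth
  | smashPt => simp only [subst_capp, List.map]; apply Conv.smashPt
  | smashMk => simp only [subst_capp, List.map, Tm.subst]; apply Conv.smashMk

theorem Conv.rename {t u : Tm} (h : Conv t u) (r : ℕ → ℕ) : Conv (t.rename r) (u.rename r) := by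
  simpa only [rename_eq_subst] using h.subst _

/-- All the free variables of a term are less than `k`. -/
def Tm.closedAt : ℕ → Tm → Bool
  | k, var n => Nat.blt n k
  | _, univ _ => true
  | k, pi A B => closedAt k A && closedAt (k + 1) B
  | k, lam A b => closedAt k A && closedAt (k + 1) b
  | k, app f a => closedAt k f && closedAt k a
  | _, const _ => true

theorem Tm.subst_of_closedAt {k : ℕ} {t : Tm} (h : t.closedAt k = true) {s : ℕ → Tm}
    (hs : ∀ n < k, s n = var n) : t.subst s = t := by
  have lift {k : ℕ} {s : ℕ → Tm} (hs : ∀ n < k, s n = var n) :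
      ∀ n < k + 1, liftSub s n = var n := by
    rintro (_ | n) hn
    · rfl
    · simp [liftSub, hs n (by omega), Tm.rename]
  induction t generalizing k s with
  | var n => exact hs n (by simpa [closedAt] using h)
  | univ i => rfl
  | pi A B ihA ihB | lam A B ihA ihB =>
    simp only [closedAt, Bool.and_eq_true] at h
    simp [Tm.subst, ihA h.1 hs, ihB h.2 (lift hs)]
  | app f a ihf iha =>
    simp only [closedAt, Bool.and_eq_true] at h
    simp [Tm.subst, ihf h.1 hs, iha h.2 hs]
  | const c => rfl

/-- Closedness does not look at universe levels, so evaluation settles each constant with its levels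
left symbolic. It makes the typing rule of constants stable under substitution. -/
theorem constType_closed (c : Const) : (constType c).closedAt 0 = true := by
  cases c <;> rfl

theorem constType_subst (c : Const) (s : ℕ → Tm) : (constType c).subst s = constType c :=
  subst_of_closedAt (constType_closed c) (by simp)

theorem constType_rename (c : Const) (r : ℕ → ℕ) : (constType c).rename r = constType c := by
  rw [rename_eq_subst, constType_subst]

/-- The type of a variable lives in the tail of the context behind it. Comparing entries only after
weakening to the full context makes the hypothesis stable under binders. -/
theorem HasType.rename {Γ : List Tm} {t A : Tm} (h : HasType Γ t A) {Δ : List Tm} {r : ℕ → ℕ}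
    (hr : ∀ n A, Γ[n]? = some A →
      ∃ A', Δ[r n]? = some A' ∧ A'.rename (· + (r n + 1)) = (A.rename (· + (n + 1))).rename r) :
    HasType Δ (t.rename r) (A.rename r) := by
  have lift {Γ Δ : List Tm} {r : ℕ → ℕ} (B : Tm) (hr : ∀ n A, Γ[n]? = some A →
      ∃ A', Δ[r n]? = some A' ∧ A'.rename (· + (r n + 1)) = (A.rename (· + (n + 1))).rename r) :
      ∀ n A, (B :: Γ)[n]? = some A → ∃ A', (B.rename r :: Δ)[liftRen r n]? = some A' ∧
        A'.rename (· + (liftRen r n + 1)) = (A.rename (· + (n + 1))).rename (liftRen r) := by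
    rintro (_ | n) A h
    · cases h
      exact ⟨_, by rfl, by simp [rename_rename, liftRen]⟩
    · obtain ⟨A', h₁, h₂⟩ := hr n A h
      refine ⟨A', h₁, ?_⟩
      have := congrArg (Tm.rename Nat.succ) h₂
      simp only [rename_rename] at this ⊢
      exact this
  induction h generalizing Δ r with
  | var h =>
    obtain ⟨A', h₁, h₂⟩ := hr _ _ h
    exact h₂ ▸ .var h₁
  | univ i => exact .univ i
  | cumul _ ih => exact (ih hr).cumul
  | pi _ _ ih₁ ih₂ => exact .pi (ih₁ hr) (ih₂ (lift _ hr))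
  | lam _ _ ih₁ ih₂ => exact .lam (ih₁ hr) (ih₂ (lift _ hr))
  | app _ _ ih₁ ih₂ => rw [rename_inst]; exact .app (ih₁ hr) (ih₂ hr)
  | const c => rw [constType_rename]; exact .const c
  | conv _ hc _ ih₁ ih₂ => exact .conv (ih₁ hr) (hc.rename _) (ih₂ hr)

theorem HasType.weaken {Γ : List Tm} {t A : Tm} (h : HasType Γ t A) (B : Tm) :
    HasType (B :: Γ) (t.rename Nat.succ) (A.rename Nat.succ) := by
  refine h.rename fun n A hA => ⟨A, hA, ?_⟩
  rw [rename_rename]; rfl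

/-- `s` is a well-typed substitution from the context `Γ` to the context `Δ`. -/
def SubstType (Δ Γ : List Tm) (s : ℕ → Tm) : Prop :=
  ∀ n A, Γ[n]? = some A → HasType Δ (s n) ((A.rename (· + (n + 1))).subst s)

theorem SubstType.lift {Δ Γ : List Tm} {s : ℕ → Tm} (hs : SubstType Δ Γ s) (B : Tm) :
    SubstType (B.subst s :: Δ) (B :: Γ) (liftSub s) := by
  rintro (_ | n) A h
  · cases h
    have e : (B.rename (· + (0 + 1))).subst (liftSub s) = (B.subst s).rename (· + (0 + 1)) := by
      simp only [subst_rename, rename_subst]; rfl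
    exact e ▸ .var rfl
  · have := (hs n A h).weaken (B.subst s)
    rw [← subst_liftSub_rename_succ] at this
    exact this

theorem HasType.subst {Γ : List Tm} {t A : Tm} (h : HasType Γ t A) {Δ : List Tm} {s : ℕ → Tm}
    (hs : SubstType Δ Γ s) : HasType Δ (t.subst s) (A.subst s) := by
  induction h generalizing Δ s with
  | var h => exact hs _ _ h
  | univ i => exact .univ i
  | cumul _ ih => exact (ih hs).cumul
  | pi _ _ ih₁ ih₂ => exact .pi (ih₁ hs) (ih₂ (hs.lift _))
  | lam _ _ ih₁ ih₂ => exact .lam (ih₁ hs) (ih₂ (hs.lift _))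
  | app _ _ ih₁ ih₂ => rw [subst_inst]; exact .app (ih₁ hs) (ih₂ hs)
  | const c => rw [constType_subst]; exact .const c
  | conv _ hc _ ih₁ ih₂ => exact .conv (ih₁ hs) (hc.subst _) (ih₂ hs)

theorem SubstType.single {Γ : List Tm} {a A : Tm} (h : HasType Γ a A) :
    SubstType Γ (A :: Γ) (Tm.single a) := by
  rintro (_ | n) B hB
  · cases hB
    simpa [subst_rename, Tm.single, subst_var] using h
  · have : HasType Γ (.var n) _ := .var hB
    rw [subst_rename]
    rw [rename_eq_subst] at this
    exact this

theorem HasType.inst {Γ : List Tm} {b B a A : Tm} (hb : HasType (A :: Γ) b B)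
    (ha : HasType Γ a A) : HasType Γ (b.inst a) (B.inst a) :=
  hb.subst (.single ha)

/-- The rules that ignore the shape of the term, `cumul` and `conv`, change only its type, so the
induction passes through them. -/
theorem HasType.pi_inv {Γ : List Tm} {A B T : Tm} (h : HasType Γ (.pi A B) T) :
    ∃ i, HasType Γ A (.univ i) ∧ HasType (A :: Γ) B (.univ i) := by
  generalize ht : Tm.pi A B = t at h
  induction h with
  | pi h₁ h₂ => cases ht; exact ⟨_, h₁, h₂⟩
  | cumul _ ih => exact ih ht
  | conv _ _ _ ih => exact ih ht
  | _ => cases ht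

theorem HasType.univ_mono {Γ : List Tm} {A : Tm} {i j : ℕ} (h : HasType Γ A (.univ i))
    (hij : i ≤ j) : HasType Γ A (.univ j) := by
  induction hij with
  | refl => exact h
  | step _ ih => exact ih.cumul

/-! ### Shifting universe levels -/

/-- Add `k` to the universe levels of a constant. -/
def Const.lift (k : ℕ) : Const → Const
  | .sig i => .sig (k + i) | .pair i => .pair (k + i) | .sigInd i j => .sigInd (k + i) (k + j)
  | .idt i => .idt (k + i) | .refl i => .refl (k + i) | .J i j => .J (k + i) (k + j)
  | .pushout i => .pushout (k + i) | .inl i => .inl (k + i) | .inr i => .inr (k + i)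
  | .push i => .push (k + i) | .pushoutInd i j => .pushoutInd (k + i) (k + j)
  | .pushoutBeta i j => .pushoutBeta (k + i) (k + j)
  | .susp i => .susp (k + i) | .north i => .north (k + i) | .south i => .south (k + i)
  | .merid i => .merid (k + i) | .suspInd i j => .suspInd (k + i) (k + j)
  | .suspBeta i j => .suspBeta (k + i) (k + j)
  | .smash i => .smash (k + i) | .smashPt i => .smashPt (k + i) | .smashMk i => .smashMk (k + i)
  | .smashL i => .smashL (k + i) | .smashR i => .smashR (k + i) | .smashLR i => .smashLR (k + i)
  | .smashInd i j => .smashInd (k + i) (k + j) | .smashBetaL i j => .smashBetaL (k + i) (k + j)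
  | .smashBetaR i j => .smashBetaR (k + i) (k + j)
  | .smashBetaLR i j => .smashBetaLR (k + i) (k + j)
  | .univalence i => .univalence (k + i)

/-- Add `k` to the universe levels of a term. -/
def Tm.lift (k : ℕ) : Tm → Tm
  | var n => var n
  | univ i => univ (k + i)
  | pi A B => pi (lift k A) (lift k B)
  | lam A b => lam (lift k A) (lift k b)
  | app f a => app (lift k f) (lift k a)
  | const c => const (c.lift k)

theorem Tm.lift_rename (k : ℕ) (r : ℕ → ℕ) (t : Tm) :
    (t.rename r).lift k = (t.lift k).rename r := by
  induction t generalizing r <;> simp_all [rename, lift]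

theorem Tm.lift_subst (k : ℕ) (s : ℕ → Tm) (t : Tm) :
    (t.subst s).lift k = (t.lift k).subst (fun n => (s n).lift k) := by
  have h (s : ℕ → Tm) : (fun n => (liftSub s n).lift k) = liftSub (fun n => (s n).lift k) := by
    funext n; cases n <;> simp [liftSub, lift, lift_rename]
  induction t generalizing s <;> simp_all [subst, lift]

theorem Tm.lift_inst (k : ℕ) (b a : Tm) : (b.inst a).lift k = (b.lift k).inst (a.lift k) := by
  simp only [inst, lift_subst]
  congr 1; funext n; cases n <;> rfl

theorem Tm.lift_capp (k : ℕ) (c : Const) (l : List Tm) :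
    (capp c l).lift k = capp (c.lift k) (l.map (lift k)) := by
  have (h : Tm) : (l.foldl app h).lift k = (l.map (lift k)).foldl app (h.lift k) := by
    induction l generalizing h <;> simp_all [lift]
  exact this _

/-- The shift adds `k` on the left: the only arithmetic on levels in `constType` is `i + 1`, and `k
+ (i + 1)` is `(k + i) + 1` by definition. -/
theorem constType_lift (k : ℕ) (c : Const) : (constType c).lift k = constType (c.lift k) := by
  cases c <;> rfl

theorem Conv.lift {t u : Tm} (h : Conv t u) (k : ℕ) : Conv (t.lift k) (u.lift k) := by
  induction h with
  | rfl => exact .rfl _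
  | symm _ ih => exact ih.symm
  | trans _ _ ih₁ ih₂ => exact ih₁.trans ih₂
  | pi _ _ ih₁ ih₂ => exact .pi ih₁ ih₂
  | lam _ _ ih₁ ih₂ => exact .lam ih₁ ih₂
  | app _ _ ih₁ ih₂ => exact .app ih₁ ih₂
  | beta A b a => rw [lift_inst]; exact .beta _ _ _
  | sigInd => simp only [lift_capp, List.map, Tm.lift, Const.lift]; apply Conv.sigInd
  | J => simp only [lift_capp, List.map, Const.lift]; apply Conv.J
  | pushoutInl => simp only [lift_capp, List.map, Tm.lift, Const.lift]; apply Conv.pushoutInl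
  | pushoutInr => simp only [lift_capp, List.map, Tm.lift, Const.lift]; apply Conv.pushoutInr
  | suspNorth => simp only [lift_capp, List.map, Const.lift]; apply Conv.suspNorth
  | suspSouth => simp only [lift_capp, List.map, Const.lift]; apply Conv.suspSouth
  | smashPt => simp only [lift_capp, List.map, Const.lift]; apply Conv.smashPt
  | smashMk => simp only [lift_capp, List.map, Tm.lift, Const.lift]; apply Conv.smashMk

theorem HasType.lift {Γ : List Tm} {t A : Tm} (h : HasType Γ t A) (k : ℕ) :
    HasType (Γ.map (Tm.lift k)) (t.lift k) (A.lift k) := by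
  induction h with
  | @var Γ n A h =>
    rw [lift_rename]
    exact .var (by simp [h])
  | univ i => exact .univ _
  | cumul _ ih => exact ih.cumul
  | pi _ _ ih₁ ih₂ => exact .pi ih₁ ih₂
  | lam _ _ ih₁ ih₂ => exact .lam ih₁ ih₂
  | app _ _ ih₁ ih₂ => rw [lift_inst]; exact .app ih₁ ih₂
  | const c => rw [constType_lift]; exact .const _
  | conv _ hc _ ih₁ ih₂ => exact .conv ih₁ (hc.lift k) ih₂

/-! ### A verified type checker

The checker works in contexts some of whose variables have a value, to which they may be unfolded.
Its answers are statements about the instances of terms under the substitutions that realize the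
context. -/

/-! ### Shifting and instantiation by recursion on the binding depth. -/

namespace Tm

/-- Add `k` to the variables that are at least `d`. -/
def shift (k : ℕ) : ℕ → Tm → Tm
  | d, var n => var (bif Nat.blt n d then n else n + k)
  | _, univ i => univ i
  | d, pi A B => pi (shift k d A) (shift k (d + 1) B)
  | d, lam A b => lam (shift k d A) (shift k (d + 1) b)
  | d, app f a => app (shift k d f) (shift k d a)
  | _, const c => const c

/-- Replace the variable `d` by `a` under `d` binders. -/
def instAt (a : Tm) : ℕ → Tm → Tm
  | d, var n => bif Nat.blt n d then var n else bif Nat.beq n d then shift d 0 a else var (n - 1)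
  | _, univ i => univ i
  | d, pi A B => pi (instAt a d A) (instAt a (d + 1) B)
  | d, lam A b => lam (instAt a d A) (instAt a (d + 1) b)
  | d, app f b => app (instAt a d f) (instAt a d b)
  | _, const c => const c

theorem blt_eq_decide (n d : ℕ) : Nat.blt n d = decide (n < d) := by
  rw [Bool.eq_iff_iff]; simp [Nat.blt_eq]

theorem beq_eq_decide (n d : ℕ) : Nat.beq n d = decide (n = d) := by
  rw [Bool.eq_iff_iff]; simp [Nat.beq_eq]

theorem shift_eq (k d : ℕ) (t : Tm) :
    shift k d t = rename (fun n => if n < d then n else n + k) t := by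
  induction t generalizing d with
  | var n => by_cases h : n < d <;> simp [shift, rename, blt_eq_decide, h]
  | pi A B ihA ihB | lam A B ihA ihB =>
    simp only [shift, rename, ihA, ihB]
    congr 2
    funext n
    rcases n with _ | n
    · simp [liftRen]
    · by_cases h : n < d <;> simp [liftRen, h]; omega
  | _ => simp_all [shift, rename]

theorem shift_zero (k : ℕ) (t : Tm) : shift k 0 t = rename (· + k) t := by
  simp [shift_eq]

theorem instAt_eq (a : Tm) (d : ℕ) (t : Tm) :
    instAt a d t = subst (fun n => if n < d then var n else
      if n = d then rename (· + d) a else var (n - 1)) t := by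
  induction t generalizing d with
  | var n =>
    by_cases h : n < d
    · simp [instAt, subst, blt_eq_decide, h]
    · by_cases h' : n = d <;> simp [instAt, subst, blt_eq_decide, beq_eq_decide, h, h', shift_zero]
  | pi A B ihA ihB | lam A B ihA ihB =>
    simp only [instAt, subst, ihA, ihB]
    congr 2
    funext n
    rcases n with _ | n
    · simp [liftSub]
    · by_cases h : n < d
      · simp [liftSub, h, rename]
      · by_cases h' : n = d
        · subst h'
          simp [liftSub, rename_rename]; rfl
        · have : n - 1 + 1 = n := by omega
          simp [liftSub, h, h', rename, this]
  | _ => simp_all [instAt, subst]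

theorem instAt_zero (a t : Tm) : instAt a 0 t = inst t a := by
  rw [instAt_eq, inst]
  congr 1
  funext n
  cases n <;> simp [single, rename_eq_subst, subst_var]

end Tm

/-- A constant as a triple of numbers. -/
def Const.key : Const → ℕ × ℕ × ℕ
  | .sig i => (0, i, 0) | .pair i => (1, i, 0) | .sigInd i j => (2, i, j)
  | .idt i => (3, i, 0) | .refl i => (4, i, 0) | .J i j => (5, i, j)
  | .pushout i => (6, i, 0) | .inl i => (7, i, 0) | .inr i => (8, i, 0) | .push i => (9, i, 0)
  | .pushoutInd i j => (10, i, j) | .pushoutBeta i j => (11, i, j)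
  | .susp i => (12, i, 0) | .north i => (13, i, 0) | .south i => (14, i, 0) | .merid i => (15, i, 0)
  | .suspInd i j => (16, i, j) | .suspBeta i j => (17, i, j)
  | .smash i => (18, i, 0) | .smashPt i => (19, i, 0) | .smashMk i => (20, i, 0)
  | .smashL i => (21, i, 0) | .smashR i => (22, i, 0) | .smashLR i => (23, i, 0)
  | .smashInd i j => (24, i, j) | .smashBetaL i j => (25, i, j) | .smashBetaR i j => (26, i, j)
  | .smashBetaLR i j => (27, i, j) | .univalence i => (28, i, 0)

/-- The constant with a given key. -/
def Const.ofKey : ℕ × ℕ × ℕ → Const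
  | (0, i, _) => .sig i | (1, i, _) => .pair i | (2, i, j) => .sigInd i j
  | (3, i, _) => .idt i | (4, i, _) => .refl i | (5, i, j) => .J i j
  | (6, i, _) => .pushout i | (7, i, _) => .inl i | (8, i, _) => .inr i | (9, i, _) => .push i
  | (10, i, j) => .pushoutInd i j | (11, i, j) => .pushoutBeta i j
  | (12, i, _) => .susp i | (13, i, _) => .north i | (14, i, _) => .south i | (15, i, _) => .merid i
  | (16, i, j) => .suspInd i j | (17, i, j) => .suspBeta i j
  | (18, i, _) => .smash i | (19, i, _) => .smashPt i | (20, i, _) => .smashMk i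
  | (21, i, _) => .smashL i | (22, i, _) => .smashR i | (23, i, _) => .smashLR i
  | (24, i, j) => .smashInd i j | (25, i, j) => .smashBetaL i j | (26, i, j) => .smashBetaR i j
  | (27, i, j) => .smashBetaLR i j | (_, i, _) => .univalence i

/-- A left inverse is all that injectivity of `key` requires, so the catch-all case of `ofKey` does
no harm. Comparing keys avoids a case for every pair of constants. -/
theorem Const.ofKey_key (c : Const) : ofKey c.key = c := by
  cases c <;> rfl

/-- Equality of constants. -/
def Const.same (c c' : Const) : Bool :=
  Nat.beq c.key.1 c'.key.1 && (Nat.beq c.key.2.1 c'.key.2.1 && Nat.beq c.key.2.2 c'.key.2.2)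

theorem Const.eq_of_same {c c' : Const} (h : c.same c' = true) : c = c' := by
  simp only [same, Bool.and_eq_true, Nat.beq_eq] at h
  rw [← ofKey_key c, ← ofKey_key c', Prod.ext h.1 (Prod.ext h.2.1 h.2.2)]

/-- Syntactic equality of terms. -/
def Tm.same : Tm → Tm → Bool
  | var n, var m => Nat.beq n m
  | univ i, univ j => Nat.beq i j
  | pi A B, pi A' B' => same A A' && same B B'
  | lam A b, lam A' b' => same A A' && same b b'
  | app f a, app f' a' => same f f' && same a a'
  | const c, const c' => c.same c'
  | _, _ => false

theorem Tm.eq_of_same {t u : Tm} (h : t.same u = true) : t = u := by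
  induction t generalizing u <;> cases u <;> simp only [same, Bool.and_eq_true, reduceCtorEq] at h
  case const.const => rw [Const.eq_of_same h]
  case var.var => rw [Nat.eq_of_beq_eq_true h]
  case univ.univ => rw [Nat.eq_of_beq_eq_true h]
  all_goals rename_i ih₁ ih₂ _ _; rw [ih₁ h.1, ih₂ h.2]

/-- Contexts of the checker: the type of each variable, and its value if it is a definition. -/
abbrev Ctx : Type := List (Tm × Option Tm)

/-- The entry of a variable. -/
def Ctx.get : Ctx → ℕ → Option (Tm × Option Tm)
  | [], _ => none
  | e :: _, 0 => some e
  | _ :: Γ, n + 1 => Ctx.get Γ n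

/-- The value of a variable. -/
def Ctx.value (Γ : Ctx) (n : ℕ) : Option Tm :=
  match Γ.get n with
  | some (_, some v) => some (shift (n + 1) 0 v)
  | _ => none

/-- The substitution `s` respects the values of the variables. -/
def Ctx.Respects (Γ : Ctx) (s : ℕ → Tm) : Prop :=
  ∀ n v, Γ.value n = some v → Conv (s n) (v.subst s)

/-- `s` realizes the context `Γ` in the context `Δ`. -/
structure Ctx.Realizes (Γ : Ctx) (s : ℕ → Tm) (Δ : List Tm) : Prop where
  type : ∀ n A o, Γ.get n = some (A, o) →
    HasType Δ (s n) ((shift (n + 1) 0 A).subst s) ∧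
      ∃ i, HasType Δ ((shift (n + 1) 0 A).subst s) (.univ i)
  respects : Γ.Respects s

theorem Ctx.Respects.lift {Γ : Ctx} {s : ℕ → Tm} (h : Γ.Respects s) (A : Tm) :
    Respects ((A, none) :: Γ) (liftSub s) := by
  rintro (_ | n) v hv
  · simp [value, get] at hv
  · simp only [value, get] at hv
    split at hv
    · next w hw =>
      cases hv
      have := (h n (shift (n + 1) 0 w) (by simp [value, hw])).rename Nat.succ
      rwa [shift_zero, ← subst_liftSub_rename_succ, ← shift_zero] at this
    · cases hv

theorem Ctx.Realizes.lift {Γ : Ctx} {s : ℕ → Tm} {Δ : List Tm} (h : Γ.Realizes s Δ) {A : Tm}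
    {i : ℕ} (hA : HasType Δ (A.subst s) (.univ i)) :
    Realizes ((A, none) :: Γ) (liftSub s) (A.subst s :: Δ) := by
  refine ⟨?_, h.respects.lift A⟩
  rintro (_ | n) B o hB
  · cases hB
    have e : (shift (0 + 1) 0 A).subst (liftSub s) = (A.subst s).rename (· + (0 + 1)) := by
      simp only [shift_zero, subst_rename, rename_subst]; rfl
    rw [e]
    exact ⟨.var rfl, i, hA.weaken _⟩
  · obtain ⟨h₁, j, h₂⟩ := h.type n B o hB
    have h₁ := h₁.weaken (A.subst s)
    have h₂ := h₂.weaken (A.subst s)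
    rw [shift_zero, ← subst_liftSub_rename_succ, ← shift_zero] at h₁ h₂
    exact ⟨h₁, j, h₂⟩

/-- A definition extends the realization by the instance of its value, while `Δ` stays the same. The
option `o` may be `none`: a value hidden from the checker is realized by the same term. -/
theorem Ctx.Realizes.cons {Γ : Ctx} {s : ℕ → Tm} {Δ : List Tm} (h : Γ.Realizes s Δ) {t A : Tm}
    {o : Option Tm} {i : ℕ} (ht : HasType Δ (t.subst s) (A.subst s))
    (hA : HasType Δ (A.subst s) (.univ i)) (ho : ∀ v, o = some v → v = t) :
    Realizes ((A, o) :: Γ) (Tm.cons (t.subst s) s) Δ := by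
  have e (B : Tm) : (shift (0 + 1) 0 B).subst (Tm.cons (t.subst s) s) = B.subst s := by
    simp only [shift_zero, subst_rename]; rfl
  refine ⟨?_, ?_⟩
  · rintro (_ | n) B o' hB
    · cases hB
      rw [e]
      exact ⟨ht, i, hA⟩
    · rw [shift_zero, subst_cons_rename_succ, ← shift_zero]
      exact h.type n B o' hB
  · rintro (_ | n) v hv
    · simp only [value, get] at hv
      split at hv
      · next w hw =>
        cases hv
        cases hw
        rw [e, ho w rfl]
        exact .rfl _
      · cases hv
    · simp only [value, get] at hv
      split at hv
      · next w hw =>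
        cases hv
        rw [shift_zero, subst_cons_rename_succ, ← shift_zero]
        exact h.respects n _ (by simp [value, hw])
      · cases hv

/-! #### Weak head normal forms -/

/-- One step of computation of an eliminator `c` applied to `l`; `w` computes the weak head normal
form of the eliminated term. -/
def iota (w : Tm → List Tm → Tm × List Tm) (c : Const) (l : List Tm) : Option (Tm × List Tm) :=
  match c with
  | .sigInd _ _ =>
    match l with
    | _ :: _ :: _ :: g :: p :: l =>
      match w p [] with
      | (.const (.pair _), [_, _, a, b]) => some (g, a :: b :: l)
      | _ => none
    | _ => none
  | .J _ _ =>
    match l with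
    | _ :: _ :: _ :: d :: _ :: p :: l =>
      match w p [] with
      | (.const (.refl _), [_, _]) => some (d, l)
      | _ => none
    | _ => none
  | .pushoutInd _ _ =>
    match l with
    | _ :: _ :: _ :: _ :: _ :: _ :: f :: g :: _ :: x :: l =>
      match w x [] with
      | (.const (.inl _), [_, _, _, _, _, b]) => some (f, b :: l)
      | (.const (.inr _), [_, _, _, _, _, c]) => some (g, c :: l)
      | _ => none
    | _ => none
  | .suspInd _ _ =>
    match l with
    | _ :: _ :: n :: s :: _ :: x :: l =>
      match w x [] with
      | (.const (.north _), [_]) => some (n, l)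
      | (.const (.south _), [_]) => some (s, l)
      | _ => none
    | _ => none
  | .smashInd _ _ =>
    match l with
    | _ :: _ :: _ :: _ :: _ :: z :: k :: _ :: _ :: _ :: x :: l =>
      match w x [] with
      | (.const (.smashPt _), [_, _, _, _]) => some (z, l)
      | (.const (.smashMk _), [_, _, _, _, p]) => some (k, p :: l)
      | _ => none
    | _ => none
  | _ => none

/-- The weak head normal form of `t` applied to `l`, as a head and a list of arguments. A variable at
the head is unfolded only if `d` is true. -/
def whnf (Γ : Ctx) : ℕ → Bool → Tm → List Tm → Tm × List Tm
  | 0, _, t, l => (t, l)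
  | n + 1, d, t, l =>
    match t with
    | .app f a => whnf Γ n d f (a :: l)
    | .lam A b =>
      match l with
      | [] => (.lam A b, [])
      | a :: l => whnf Γ n d (instAt a 0 b) l
    | .var k =>
      match bif d then Γ.value k else none with
      | some v => whnf Γ n d v l
      | none => (.var k, l)
    | .const c =>
      match iota (whnf Γ n true) c l with
      | some (u, l') => whnf Γ n d u l'
      | none => (.const c, l)
    | .univ i => (.univ i, l)
    | .pi A B => (.pi A B, l)

/-- A head applied to a list of arguments. -/
def unspine (p : Tm × List Tm) : Tm := p.2.foldl .app p.1

theorem Conv.foldl_app {h h' : Tm} (hh : Conv h h') (l : List Tm) :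
    Conv (l.foldl .app h) (l.foldl .app h') := by
  induction l generalizing h h' with
  | nil => exact hh
  | cons a l ih => exact ih (hh.app (.rfl a))

/-- The eliminated term converts to its weak head normal form by `hw`, and then a computation rule
applies. The rules do not ask the parameters of the constructor to match those of the eliminator, so
these need no comparison. -/
theorem iota_conv {s : ℕ → Tm} {w : Tm → List Tm → Tm × List Tm}
    (hw : ∀ t l, Conv ((unspine (t, l)).subst s) ((unspine (w t l)).subst s)) {c : Const}
    {l : List Tm} {r : Tm × List Tm} (h : iota w c l = some r) :
    Conv ((unspine (.const c, l)).subst s) ((unspine r).subst s) := by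
  have key {f p q r : Tm} (l : List Tm) (hp : Conv (p.subst s) (q.subst s))
      (hr : Conv ((Tm.app f q).subst s) (r.subst s)) :
      Conv ((unspine (.app f p, l)).subst s) ((unspine (r, l)).subst s) := by
    simp only [unspine, subst_foldl_app]
    exact Conv.foldl_app (((Conv.rfl _).app hp).trans hr) _
  unfold iota at h
  split at h
  case h_1 =>
    split at h
    · split at h
      · next A B C g p l _ i A' B' a b e =>
        cases h
        have hp := hw p []
        rw [e] at hp
        exact key (f := capp _ [A, B, C, g]) (r := .app (.app g a) b) l hp
          ((Conv.sigInd _ _ _ _ _ _ _ _ _ _ _).subst s)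
      · cases h
    · cases h
  case h_2 =>
    split at h
    · split at h
      · next A x C d y p l _ i A' x' e =>
        cases h
        have hp := hw p []
        rw [e] at hp
        exact key (f := capp _ [A, x, C, d, y]) l hp ((Conv.J _ _ _ _ _ _ _ _ _ _).subst s)
      · cases h
    · cases h
  case h_3 =>
    split at h
    · split at h
      · next A B C f g P k m n x l _ i A' B' C' f' g' b e =>
        cases h
        have hp := hw x []
        rw [e] at hp
        exact key (f := capp _ [A, B, C, f, g, P, k, m, n]) (r := .app k b) l hp
          ((Conv.pushoutInl _ _ _ _ _ _ _ _ _ _ _ _ _ _ _ _ _ _).subst s)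
      · next A B C f g P k m n x l _ i A' B' C' f' g' b e =>
        cases h
        have hp := hw x []
        rw [e] at hp
        exact key (f := capp _ [A, B, C, f, g, P, k, m, n]) (r := .app m b) l hp
          ((Conv.pushoutInr _ _ _ _ _ _ _ _ _ _ _ _ _ _ _ _ _ _).subst s)
      · cases h
    · cases h
  case h_4 =>
    split at h
    · split at h
      · next A P n m k x l _ i A' e =>
        cases h
        have hp := hw x []
        rw [e] at hp
        exact key (f := capp _ [A, P, n, m, k]) l hp ((Conv.suspNorth _ _ _ _ _ _ _ _ _).subst s)
      · next A P n m k x l _ i A' e =>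
        cases h
        have hp := hw x []
        rw [e] at hp
        exact key (f := capp _ [A, P, n, m, k]) l hp ((Conv.suspSouth _ _ _ _ _ _ _ _ _).subst s)
      · cases h
    · cases h
  case h_5 =>
    split at h
    · split at h
      · next A a B b P z k u v m x l _ i A' a' B' b' e =>
        cases h
        have hp := hw x []
        rw [e] at hp
        exact key (f := capp _ [A, a, B, b, P, z, k, u, v, m]) l hp
          ((Conv.smashPt _ _ _ _ _ _ _ _ _ _ _ _ _ _ _ _ _).subst s)
      · next A a B b P z k u v m x l _ i A' a' B' b' p e =>
        cases h
        have hp := hw x []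
        rw [e] at hp
        exact key (f := capp _ [A, a, B, b, P, z, k, u, v, m]) (r := .app k p) l hp
          ((Conv.smashMk _ _ _ _ _ _ _ _ _ _ _ _ _ _ _ _ _ _).subst s)
      · cases h
    · cases h
  case h_6 => cases h

/-- Each step replaces a term by a convertible one, and exhausted fuel returns the term as it
stands. Neither termination nor normality is claimed. -/
theorem whnf_conv {Γ : Ctx} {s : ℕ → Tm} (hs : Γ.Respects s) (n : ℕ) (d : Bool) (t : Tm)
    (l : List Tm) : Conv ((unspine (t, l)).subst s) ((unspine (whnf Γ n d t l)).subst s) := by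
  induction n generalizing d t l with
  | zero => exact .rfl _
  | succ n ih =>
    unfold whnf
    split
    · next f a => exact ih d f (a :: l)
    · split
      · exact .rfl _
      · rw [instAt_zero]
        refine Conv.trans ?_ (ih _ _ _)
        simp only [unspine, subst_foldl_app, List.foldl]
        exact Conv.foldl_app ((Conv.beta _ _ _).subst s) _
    · split
      · next k v hv =>
        refine Conv.trans ?_ (ih _ _ _)
        simp only [unspine, subst_foldl_app]
        cases d
        · cases hv
        · exact Conv.foldl_app (hs _ _ hv) _
      · exact .rfl _
    · split
      · next h => exact (iota_conv (ih true) h).trans (ih _ _ _)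
      · exact .rfl _
    · exact .rfl _
    · exact .rfl _

/-! #### Conversion -/

/-- Comparison of two lists of arguments. -/
def convArgs (f : Tm → Tm → Bool) : List Tm → List Tm → Bool
  | [], [] => true
  | a :: l, b :: m => f a b && convArgs f l m
  | _, _ => false

/-- Comparison of two heads. -/
def convHead (f : Ctx → Tm → Tm → Bool) (Γ : Ctx) : Tm → Tm → Bool
  | .var n, .var m => Nat.beq n m
  | .univ i, .univ j => Nat.beq i j
  | .pi A B, .pi A' B' => f Γ A A' && f ((A, none) :: Γ) B B'
  | .lam A b, .lam A' b' => f Γ A A' && f ((A, none) :: Γ) b b'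
  | .const c, .const c' => c.same c'
  | _, _ => false

/-- Comparison of two terms in head and argument form. -/
def convSpine (f : Ctx → Tm → Tm → Bool) (Γ : Ctx) (p q : Tm × List Tm) : Bool :=
  convHead f Γ p.1 q.1 && convArgs (f Γ) p.2 q.2

/-- The variable at the head, and the term that results from unfolding it. -/
def unfoldHead (Γ : Ctx) (p : Tm × List Tm) : Option (ℕ × Tm) :=
  match p.1 with
  | .var k =>
    match Γ.value k with
    | some v => some (k, unspine (v, p.2))
    | none => none
  | _ => none

/-- Comparison of two terms in head and argument form that unfolds the most recent definition. -/
def convUnfold (f : Ctx → Tm → Tm → Bool) (Γ : Ctx) (p q : Tm × List Tm) : Bool :=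
  match unfoldHead Γ p, unfoldHead Γ q with
  | some (k, t), some (m, u) =>
    -- With the same definition at both heads, the arguments are compared before anything is
    -- unfolded. Otherwise the smaller index is the later definition, which may mention the other
    -- one, so it is unfolded first.
    bif Nat.beq k m then convSpine f Γ p q || f Γ t u
    else bif Nat.blt k m then f Γ t (unspine q) else f Γ (unspine p) u
  | some (_, t), none => f Γ t (unspine q)
  | none, some (_, u) => f Γ (unspine p) u
  | none, none => convSpine f Γ p q

/-- The bound on the number of steps in the computation of a weak head normal form. -/
def whnfFuel : ℕ := 100000

/-- Convertibility. -/
def conv : ℕ → Ctx → Tm → Tm → Bool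
  | 0, _, _, _ => false
  | n + 1, Γ, t, u => t.same u ||
      convUnfold (conv n) Γ (whnf Γ whnfFuel false t []) (whnf Γ whnfFuel false u [])

theorem convArgs_conv {s : ℕ → Tm} {f : Tm → Tm → Bool}
    (hf : ∀ t u, f t u = true → Conv (t.subst s) (u.subst s)) {l m : List Tm}
    (h : convArgs f l m = true) {t u : Tm} (htu : Conv (t.subst s) (u.subst s)) :
    Conv ((unspine (t, l)).subst s) ((unspine (u, m)).subst s) := by
  induction l generalizing m t u with
  | nil =>
    cases m with
    | nil => exact htu
    | cons => cases h
  | cons a l ih =>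
    cases m with
    | nil => cases h
    | cons b m =>
      simp only [convArgs, Bool.and_eq_true] at h
      exact ih (t := .app t a) (u := .app u b) h.2 (htu.app (hf _ _ h.1))

theorem convSpine_conv {f : Ctx → Tm → Tm → Bool}
    (hf : ∀ {Γ : Ctx} {s : ℕ → Tm}, Γ.Respects s →
      ∀ {t u}, f Γ t u = true → Conv (t.subst s) (u.subst s))
    {Γ : Ctx} {s : ℕ → Tm} (hs : Γ.Respects s) {p q : Tm × List Tm}
    (h : convSpine f Γ p q = true) : Conv ((unspine p).subst s) ((unspine q).subst s) := by
  simp only [convSpine, Bool.and_eq_true] at h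
  refine convArgs_conv (fun _ _ => hf hs) h.2 ?_
  have h := h.1
  unfold convHead at h
  split at h
  · next e₁ e₂ => rw [e₁, e₂, Nat.eq_of_beq_eq_true h]; exact .rfl _
  · next e₁ e₂ => rw [e₁, e₂, Nat.eq_of_beq_eq_true h]; exact .rfl _
  · next e₁ e₂ =>
    simp only [Bool.and_eq_true] at h
    rw [e₁, e₂]
    exact .pi (hf hs h.1) (hf (hs.lift _) h.2)
  · next e₁ e₂ =>
    simp only [Bool.and_eq_true] at h
    rw [e₁, e₂]
    exact .lam (hf hs h.1) (hf (hs.lift _) h.2)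
  · next e₁ e₂ => rw [e₁, e₂, Const.eq_of_same h]; exact .rfl _
  · cases h

theorem unfoldHead_conv {Γ : Ctx} {s : ℕ → Tm} (hs : Γ.Respects s) {p : Tm × List Tm} {k : ℕ}
    {t : Tm} (h : unfoldHead Γ p = some (k, t)) : Conv ((unspine p).subst s) (t.subst s) := by
  unfold unfoldHead at h
  split at h
  · next n e =>
    split at h
    · next v hv =>
      cases h
      simp only [unspine, subst_foldl_app, e]
      exact Conv.foldl_app (hs _ _ hv) _
    · cases h
  · cases h

theorem convUnfold_conv {f : Ctx → Tm → Tm → Bool}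
    (hf : ∀ {Γ : Ctx} {s : ℕ → Tm}, Γ.Respects s →
      ∀ {t u}, f Γ t u = true → Conv (t.subst s) (u.subst s))
    {Γ : Ctx} {s : ℕ → Tm} (hs : Γ.Respects s) {p q : Tm × List Tm}
    (h : convUnfold f Γ p q = true) : Conv ((unspine p).subst s) ((unspine q).subst s) := by
  unfold convUnfold at h
  split at h
  · next e₁ e₂ =>
    have h₁ := unfoldHead_conv hs e₁
    have h₂ := unfoldHead_conv hs e₂
    simp only [Bool.cond_eq_ite] at h
    split at h
    · rcases Bool.or_eq_true _ _ ▸ h with h | h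
      · exact convSpine_conv hf hs h
      · exact h₁.trans ((hf hs h).trans h₂.symm)
    · split at h
      · exact h₁.trans (hf hs h)
      · exact (hf hs h).trans h₂.symm
  · next e₁ _ => exact (unfoldHead_conv hs e₁).trans (hf hs h)
  · next _ e₂ => exact (hf hs h).trans (unfoldHead_conv hs e₂).symm
  · exact convSpine_conv hf hs h

/-- Conversion is untyped, so only the values of the variables matter here. The induction on the
fuel ranges over all contexts, since the comparison goes under binders. -/
theorem conv_sound (n : ℕ) {Γ : Ctx} {s : ℕ → Tm} (hs : Γ.Respects s) {t u : Tm}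
    (h : conv n Γ t u = true) : Conv (t.subst s) (u.subst s) := by
  induction n generalizing Γ s t u with
  | zero => cases h
  | succ n ih =>
    simp only [conv, Bool.or_eq_true] at h
    rcases h with h | h
    · rw [eq_of_same h]; exact .rfl _
    · exact (whnf_conv hs whnfFuel false t []).trans
        ((convUnfold_conv ih hs h).trans (whnf_conv hs whnfFuel false u []).symm)

/-! #### Type inference -/

/-- The universe to which a term reduces. -/
def sortOf (Γ : Ctx) (T : Option Tm) : Option ℕ :=
  match T with
  | some T =>
    match whnf Γ whnfFuel true T [] with
    | (.univ i, []) => some i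
    | _ => none
  | none => none

/-- The function type to which a type reduces; `r` checks the types of reducts. -/
def piView (r : Ctx → Tm → Bool) (Γ : Ctx) (T : Tm) : Option (Tm × Tm) :=
  match T with
  | .pi A B => some (A, B)
  | T =>
    match whnf Γ whnfFuel true T [] with
    | (.pi A B, []) => bif r Γ (.pi A B) then some (A, B) else none
    | _ => none

/-- The bound on the depth of comparisons. -/
def convFuel : ℕ := 1000

/-- Type inference with the constants satisfying `ok`; `r` checks the types of reducts. -/
def inferWith (ok : Const → Bool) (r : Ctx → Tm → Bool) : Ctx → Tm → Option Tm
  | Γ, .var n =>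
    match Γ.get n with
    | some (A, _) => some (shift (n + 1) 0 A)
    | none => none
  | _, .univ i => some (.univ (i + 1))
  | Γ, .pi A B =>
    match sortOf Γ (inferWith ok r Γ A) with
    | some i =>
      match sortOf ((A, none) :: Γ) (inferWith ok r ((A, none) :: Γ) B) with
      | some j => some (.univ (bif Nat.ble i j then j else i))
      | none => none
    | none => none
  | Γ, .lam A b =>
    match sortOf Γ (inferWith ok r Γ A) with
    | some _ =>
      match inferWith ok r ((A, none) :: Γ) b with
      | some B => some (.pi A B)
      | none => none
    | none => none
  | Γ, .app f a =>
    match inferWith ok r Γ f with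
    | some F =>
      match piView r Γ F with
      | some (A, B) =>
        match inferWith ok r Γ a with
        | some A' => bif conv convFuel Γ A' A then some (instAt a 0 B) else none
        | none => none
      | none => none
    | none => none
  | _, .const c => bif ok c then some (constType c) else none

/-- Type inference; `n` bounds the nesting of the checks of reducts. -/
def infer (ok : Const → Bool) : ℕ → Ctx → Tm → Option Tm
  | 0 => inferWith ok fun _ _ => false
  | n + 1 => inferWith ok fun Γ T => (sortOf Γ (infer ok n Γ T)).isSome

theorem sortOf_sound {Γ : Ctx} {s : ℕ → Tm} {Δ : List Tm} (hs : Γ.Respects s) {t : Tm}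
    {T : Option Tm} {i : ℕ} (hT : ∀ T', T = some T' → HasType Δ t (T'.subst s))
    (h : sortOf Γ T = some i) : HasType Δ t (.univ i) := by
  unfold sortOf at h
  split at h
  · next T =>
    split at h
    · next e =>
      cases h
      have := whnf_conv hs whnfFuel true T []
      rw [e] at this
      exact .conv (hT T rfl) this (.univ _)
    · cases h
  · cases h

/-- `HasType.conv` demands a well-formed target. Instead of relying on preservation of types under
reduction, `r` checks the reduct anew; in `sortOf` this is superfluous because the target is a
universe. -/
theorem piView_sound {r : Ctx → Tm → Bool} {Γ : Ctx} {s : ℕ → Tm} {Δ : List Tm}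
    (hs : Γ.Respects s)
    (hr : ∀ T, r Γ T = true → ∃ i, HasType Δ (T.subst s) (.univ i)) {T A B : Tm} {t : Tm}
    (ht : HasType Δ t (T.subst s)) (hT : ∃ i, HasType Δ (T.subst s) (.univ i))
    (h : piView r Γ T = some (A, B)) :
    HasType Δ t ((Tm.pi A B).subst s) ∧ ∃ i, HasType Δ ((Tm.pi A B).subst s) (.univ i) := by
  unfold piView at h
  split at h
  · cases h
    exact ⟨ht, hT⟩
  · split at h
    · next e =>
      simp only [Bool.cond_eq_ite, Option.ite_none_right_eq_some, Option.some.injEq,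
        Prod.mk.injEq] at h
      obtain ⟨h, rfl, rfl⟩ := h
      have := whnf_conv hs whnfFuel true T []
      rw [e] at this
      obtain ⟨i, hi⟩ := hr _ h
      exact ⟨.conv ht this hi, i, hi⟩
    · cases h

theorem HasType.weaken_closed {t : Tm} {i : ℕ} (h : HasType [] t (.univ i)) (Δ : List Tm) :
    HasType Δ (t.rename id) (.univ i) :=
  h.rename (r := id) (by simp)

/-- The types of the constants that satisfy `ok` are well-formed. -/
def WellFormedConsts (ok : Const → Bool) : Prop :=
  ∀ c, ok c = true → ∃ i, HasType [] (constType c) (.univ i)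

/-- Well-formedness of the inferred type is carried along for the application case: inverting the
function type gives a well-formed domain, to which the type of the argument can be converted, and a
well-formed codomain, whose instance is the new type. -/
theorem inferWith_sound {ok : Const → Bool} {r : Ctx → Tm → Bool} (hok : WellFormedConsts ok)
    (hr : ∀ {Γ s Δ}, Ctx.Realizes Γ s Δ →
      ∀ T, r Γ T = true → ∃ i, HasType Δ (T.subst s) (.univ i))
    {Γ : Ctx} {s : ℕ → Tm} {Δ : List Tm} (hs : Γ.Realizes s Δ) {t T : Tm}
    (h : inferWith ok r Γ t = some T) :
    HasType Δ (t.subst s) (T.subst s) ∧ ∃ i, HasType Δ (T.subst s) (.univ i) := by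
  induction t generalizing Γ s Δ T with
  | var n =>
    simp only [inferWith] at h
    split at h
    · next e => cases h; exact hs.type _ _ _ e
    · cases h
  | univ i => cases h; exact ⟨.univ _, _, .univ _⟩
  | pi A B ihA ihB =>
    simp only [inferWith] at h
    split at h
    · next i hi =>
      have hA := sortOf_sound hs.respects (fun _ h => (ihA hs h).1) hi
      have hs' := hs.lift hA
      split at h
      · next j hj =>
        cases h
        have hB := sortOf_sound hs'.respects (fun _ h => (ihB hs' h).1) hj
        refine ⟨?_, _, .univ _⟩
        by_cases hij : i ≤ j
        · simpa [hij, Bool.cond_eq_ite] using .pi (hA.univ_mono hij) hB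
        · simpa [hij, Bool.cond_eq_ite] using .pi hA (hB.univ_mono (Nat.le_of_not_le hij))
      · cases h
    · cases h
  | lam A b ihA ihb =>
    simp only [inferWith] at h
    split at h
    · next i hi =>
      have hA := sortOf_sound hs.respects (fun _ h => (ihA hs h).1) hi
      split at h
      · next B hB =>
        cases h
        obtain ⟨hb, j, hj⟩ := ihb (hs.lift hA) hB
        exact ⟨.lam hA hb, max i j, .pi (hA.univ_mono (le_max_left _ _))
          (hj.univ_mono (le_max_right _ _))⟩
      · cases h
    · cases h
  | app f a ihf iha =>
    simp only [inferWith] at h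
    split at h
    · next F hF =>
      obtain ⟨hf, hF⟩ := ihf hs hF
      split at h
      · next A B hAB =>
        obtain ⟨hf, i, hi⟩ := piView_sound hs.respects (hr hs) hf hF hAB
        obtain ⟨j, hA, hB⟩ := hi.pi_inv
        split at h
        · next A' hA' =>
          simp only [Bool.cond_eq_ite, Option.ite_none_right_eq_some, Option.some.injEq] at h
          obtain ⟨h, rfl⟩ := h
          have ha := HasType.conv (iha hs hA').1 (conv_sound _ hs.respects h) hA
          rw [instAt_zero, subst_inst]
          exact ⟨.app hf ha, j, hB.inst ha⟩
        · cases h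
      · cases h
    · cases h
  | const c =>
    simp only [inferWith, Bool.cond_eq_ite, Option.ite_none_right_eq_some, Option.some.injEq] at h
    obtain ⟨h, rfl⟩ := h
    obtain ⟨i, hi⟩ := hok c h
    rw [constType_subst]
    have := hi.weaken_closed Δ
    rw [constType_rename] at this
    exact ⟨.const c, i, this⟩

theorem infer_sound {ok : Const → Bool} (hok : WellFormedConsts ok) (n : ℕ) {Γ : Ctx} {s : ℕ → Tm}
    {Δ : List Tm} (hs : Γ.Realizes s Δ) {t T : Tm} (h : infer ok n Γ t = some T) :
    HasType Δ (t.subst s) (T.subst s) ∧ ∃ i, HasType Δ (T.subst s) (.univ i) := by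
  induction n generalizing Γ s Δ t T with
  | zero => exact inferWith_sound hok (fun _ _ h => by cases h) hs h
  | succ n ih =>
    refine inferWith_sound hok (fun {Γ s Δ} hs T h => ?_) hs h
    obtain ⟨i, hi⟩ := Option.isSome_iff_exists.1 h
    exact ⟨i, sortOf_sound hs.respects (fun _ h => (ih hs h).1) hi⟩

/-- Check that `t` has the type `T`, and that the type `T` is well-formed. -/
def check (ok : Const → Bool) (Γ : Ctx) (t T : Tm) : Bool :=
  match sortOf Γ (infer ok 5 Γ T) with
  | some _ =>
    match infer ok 5 Γ t with
    | some T' => conv convFuel Γ T' T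
    | none => false
  | none => false

theorem check_sound {ok : Const → Bool} (hok : WellFormedConsts ok) {Γ : Ctx} {s : ℕ → Tm}
    {Δ : List Tm} (hs : Γ.Realizes s Δ) {t T : Tm} (h : check ok Γ t T = true) :
    HasType Δ (t.subst s) (T.subst s) ∧ ∃ i, HasType Δ (T.subst s) (.univ i) := by
  unfold check at h
  split at h
  · next i hi =>
    have hT := sortOf_sound hs.respects (fun _ h => (infer_sound hok 5 hs h).1) hi
    split at h
    · next T' hT' =>
      exact ⟨.conv (infer_sound hok 5 hs hT').1 (conv_sound _ hs.respects h) hT, i, hT⟩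
    · cases h
  · cases h

/-- Membership of a constant in a list. -/
def mem (l : List Const) (c : Const) : Bool :=
  match l with
  | [] => false
  | d :: l => d.same c || mem l c

/-- Check that the types of the constants in `l` are well-formed. -/
def checkConsts (ok : Const → Bool) : List Const → Bool
  | [] => true
  | c :: l => (sortOf [] (infer ok 5 [] (constType c))).isSome && checkConsts ok l

/-- The types of the constants in `l` are checked with the constants of `m` alone, so
well-formedness is built up in stages without circularity. -/
theorem WellFormedConsts.append {l m : List Const} (hm : WellFormedConsts (mem m))
    (h : checkConsts (mem m) l = true) : WellFormedConsts (mem (l ++ m)) := by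
  induction l with
  | nil => exact hm
  | cons c l ih =>
    simp only [checkConsts, Bool.and_eq_true] at h
    intro d hd
    rw [List.cons_append, mem, Bool.or_eq_true] at hd
    rcases hd with hd | hd
    · obtain ⟨i, hi⟩ := Option.isSome_iff_exists.1 h.1
      obtain rfl := Const.eq_of_same hd
      have hnil : Ctx.Realizes [] Tm.var [] :=
        ⟨fun _ _ _ h => (nomatch h), fun _ _ h => (nomatch h)⟩
      have := sortOf_sound hnil.respects (fun _ h => (infer_sound hm 5 hnil h).1) hi
      rw [subst_var] at this
      exact ⟨i, this⟩
    · exact ih h.2 d hd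

set_option linter.unusedVariables false

/-! ### The constants of level `0` -/

/-- Stages for `WellFormedConsts.append`: the type of a constant mentions only constants of earlier
stages. `.J 0 1` is there for `rightIndDef`, whose motive quantifies over families in `U 0`. -/
def formationConsts : List Const := [.idt 0, .sig 0, .pushout 0, .susp 0, .smash 0]

def pointConsts : List Const :=
  [.pair 0, .refl 0, .inl 0, .inr 0, .north 0, .south 0, .smashPt 0, .smashMk 0]

def pathConsts : List Const := [.sigInd 0 0, .J 0 0, .J 0 1, .push 0, .merid 0, .smashL 0, .smashR 0]

def eliminatorConsts : List Const := [.pushoutInd 0 0, .suspInd 0 0, .smashLR 0]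

def smashConsts : List Const := [.smashInd 0 0, .pushoutBeta 0 0, .suspBeta 0 0]

def computationConsts : List Const := [.smashBetaL 0 0, .smashBetaR 0 0]

/-- The constants whose types are known to be well-formed. -/
def consts : List Const :=
  computationConsts ++ (smashConsts ++ (eliminatorConsts ++ (pathConsts ++ (pointConsts ++
    (formationConsts ++ [])))))

theorem wellFormedConsts_consts : WellFormedConsts (mem consts) := by
  have h : WellFormedConsts (mem []) := fun c h => nomatch h
  refine .append (.append (.append (.append (.append (.append h ?_) ?_) ?_) ?_) ?_) ?_ <;>
    decide +kernel

/-! ### Libraries of definitions -/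

/-- An expression that is claimed to have the type `T`. The claim is verified by the checker; the
index serves to infer implicit arguments. -/
structure El (T : Exp) : Type where
  exp : Exp

instance {T : Exp} : CoeOut (El T) Exp := ⟨El.exp⟩

/-- A definition, which may use the variables at the levels less than its position. -/
structure Def : Type where
  type : Exp
  value : Exp
  transparent : Bool

/-- A definition that can be unfolded. -/
def El.transparent {T : Exp} (t : El T) : Def := ⟨T, t.exp, true⟩

/-- A definition that cannot be unfolded. -/
def El.sealed {T : Exp} (t : El T) : Def := ⟨T, t.exp, false⟩

/-- The context entry of a definition that is preceded by `n` definitions. -/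
def Def.entry (e : Def) (n : ℕ) : Tm × Option Tm :=
  (e.type.toTm n, bif e.transparent then some (e.value.toTm n) else none)

/-- Extension of a context of length `n` by definitions. -/
def Ctx.extend (Γ : Ctx) (n : ℕ) : List Def → Ctx
  | [] => Γ
  | e :: l => Ctx.extend (e.entry n :: Γ) (n + 1) l

/-- Check a list of definitions in a context of length `n`. -/
def checkDefs (Γ : Ctx) (n : ℕ) : List Def → Bool
  | [] => true
  | e :: l => check (mem consts) Γ (e.value.toTm n) (e.type.toTm n) &&
      checkDefs (e.entry n :: Γ) (n + 1) l

/-- Some substitution realizes the context `Γ`. -/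
def Ctx.Realizable (Γ : Ctx) : Prop := ∃ s, Γ.Realizes s []

theorem Ctx.realizable_nil : Realizable [] :=
  ⟨Tm.var, fun _ _ _ h => (nomatch h), fun _ _ h => (nomatch h)⟩

/-- The value of a definition, instantiated with the terms that realize the earlier ones, is again a
term typed in the empty context and realizes the new entry. -/
theorem Ctx.Realizable.extend {Γ : Ctx} (h : Γ.Realizable) {n : ℕ} {l : List Def}
    (hl : checkDefs Γ n l = true) : (Γ.extend n l).Realizable := by
  induction l generalizing Γ n with
  | nil => exact h
  | cons e l ih =>
    simp only [checkDefs, Bool.and_eq_true] at hl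
    obtain ⟨s, hs⟩ := h
    obtain ⟨ht, i, hi⟩ := check_sound wellFormedConsts_consts hs hl.1
    refine ih ⟨_, hs.cons ht hi fun v hv => ?_⟩ hl.2
    revert hv
    cases e.transparent <;> simp +contextual [eq_comm]

/-! ### Typed expressions -/

/-- `Π x : A, B x`. -/
def Pi (A : Exp) (B : El A → Exp) : Exp := pi A fun x => B ⟨x⟩

/-- `A → B`. -/
def Arr (A B : Exp) : Exp := Pi A fun _ => B

/-- `fun x : A => b x`. -/
def Lam {A : Exp} {B : El A → Exp} (b : (x : El A) → El (B x)) : El (Pi A B) :=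
  ⟨lam A fun x => b ⟨x⟩⟩

instance {A : Exp} {B : El A → Exp} : CoeFun (El (Pi A B)) fun _ => (x : El A) → El (B x) :=
  ⟨fun f x => ⟨f.exp x⟩⟩

instance {A B : Exp} : CoeFun (El (Arr A B)) fun _ => El A → El B :=
  ⟨fun f x => ⟨f.exp x⟩⟩

/-- An expression of a convertible type. -/
def El.cast {T T' : Exp} (t : El T) : El T' := ⟨t.exp⟩

/-- `x = y`. -/
def Id {A : Exp} (x y : El A) : Exp := idt 0 A x y

/-- The constant path between convertible points. -/
def rfl' {A : Exp} {x y : El A} : El (Id x y) := ⟨refl 0 A x⟩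

/-- Path induction. -/
def J {A : Exp} {x : El A} {C : (y : El A) → El (Id x y) → Exp} {y : El A} (p : El (Id x y))
    (d : El (C x rfl')) : El (C y p) :=
  ⟨cst (.J 0 0) A x (lam A fun y => lam (idt 0 A x y) fun p => C ⟨y⟩ ⟨p⟩) d y p⟩

/-- Path induction into types of level `1`. -/
def J₁ {A : Exp} {x : El A} {C : (y : El A) → El (Id x y) → Exp} {y : El A} (p : El (Id x y))
    (d : El (C x rfl')) : El (C y p) :=
  ⟨cst (.J 0 1) A x (lam A fun y => lam (idt 0 A x y) fun p => C ⟨y⟩ ⟨p⟩) d y p⟩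

/-- The names of the definitions, in order. -/
inductive Label : Type
  | symm | trans | ap | tr | rightInd | leftUnit | assoc | cancel
  | zigzag | zigzagEta | apZigzag | zigzagL | zigzagR | zigzagLR | zigzagMid | zigzagContract
  | apZigzagL | apZigzagR | contractL | contractR | paste
  | apdConst | trConst | overRetract | overSquare
  | cancelSymm | fibPath | centerPath | quasiInverse
  | smashPair | smashIndWeak | smashRec | smashRecL | smashRecR | suspRec | suspRecMerid
  | join | joinL | joinR | glue | pinch | apPinch | pinchGlue
  | detour | detourL | detourR | detourLR | smashPath | smashPathL | smashPathR
  | unpinch | apUnpinch | unpinchMerid | retractionL | retractionR | retractionGlue | retraction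
  | meridL | meridR | meridLR | apPinchZigzag | apPinchDetour | apPinchDetourL | apPinchDetourR
  | apPinchSmashPathL | apPinchSmashPathR | apPinchOverL | apPinchOverR | apPinchPath
  | sectMerid | sect

/-- The definition with a given name. -/
def ref (n : Label) : Exp := Exp.level n.ctorIdx

/-! ### Paths -/

def symmDef : El (Pi (U 0) fun X => Pi X fun x => Pi X fun y => Pi (Id x y) fun _ => Id y x) :=
  Lam fun X => Lam fun x => Lam fun y => Lam fun p => by
    apply J p
    exact rfl'

/-- The inverse of a path. -/
def inv {X : Exp} {x y : El X} (p : El (Id x y)) : El (Id y x) := ⟨ref .symm X x y p⟩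

/-- Composition is defined by induction on the second path: `p ⬝ rfl'` computes to `p`, while `rfl'
⬝ p = p` needs `leftUnit`. Many conversions below rest on this. -/
def transDef : El (Pi (U 0) fun X => Pi X fun x => Pi X fun y => Pi X fun z =>
    Pi (Id x y) fun _ => Pi (Id y z) fun _ => Id x z) :=
  Lam fun X => Lam fun x => Lam fun y => Lam fun z => Lam fun p => Lam fun q =>
    ⟨concat 0 X x y z p q⟩

/-- Composition of paths. -/
def trans {X : Exp} {x y z : El X} (p : El (Id x y)) (q : El (Id y z)) : El (Id x z) :=
  ⟨ref .trans X x y z p q⟩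

infixl:65 " ⬝ " => trans

def apDef : El (Pi (U 0) fun X => Pi (U 0) fun Y => Pi (Arr X Y) fun f => Pi X fun x =>
    Pi X fun y => Pi (Id x y) fun _ => Id (f x) (f y)) :=
  Lam fun X => Lam fun Y => Lam fun f => Lam fun x => Lam fun y => Lam fun p =>
    ⟨HoTT.ap 0 0 X Y f x y p⟩

/-- The action of a function on a path. -/
def ap' {X Y : Exp} (f : El (Arr X Y)) {x y : El X} (p : El (Id x y)) : El (Id (f x) (f y)) :=
  ⟨ref .ap X Y f x y p⟩

/-- The image of a path under a function given by an expression with a free variable. -/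
def cong {X Y : Exp} (f : El X → El Y) {x y : El X} (p : El (Id x y)) : El (Id (f x) (f y)) :=
  ⟨ref .ap X Y (lam X fun x => f ⟨x⟩) x y p⟩

def trDef : El (Pi (U 0) fun X => Pi (Arr X (U 0)) fun P => Pi X fun x => Pi X fun y =>
    Pi (Id x y) fun _ => Arr (P x) (P y)) :=
  Lam fun X => Lam fun P => Lam fun x => Lam fun y => Lam fun p =>
    ⟨transport 0 0 X P x y p⟩

/-- Transport along a path. -/
def tr {X : Exp} (P : El X → Exp) {x y : El X} (p : El (Id x y)) (u : El (P x)) : El (P y) :=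
  ⟨ref .tr X (lam X fun x => P ⟨x⟩) x y p u⟩

/-- Dependent paths. -/
def Over {X : Exp} (P : El X → Exp) {x y : El X} (p : El (Id x y)) (u : El (P x)) (v : El (P y)) :
    Exp :=
  Id (tr P p u) v

/-- The primitive induction fixes the left end. Quantifying over the family `C` inside the motive
lets the right end vary instead, at the price of a motive in `U 1`. -/
def rightIndDef : El (Pi (U 0) fun X => Pi X fun y =>
    Pi (Pi X fun x => Arr (Id x y) (U 0)) fun C => Pi (C y rfl') fun _ => Pi X fun x =>
    Pi (Id x y) fun p => C x p) :=
  Lam fun X => Lam fun y => Lam fun C => Lam fun d => Lam fun x => Lam fun p =>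
    let e : El (Pi (Pi X fun x' => Arr (Id x' y) (U 0)) fun C => Arr (C y rfl') (C x p)) := by
      apply J₁ p
      exact Lam fun C => (Lam fun d => d : El (Arr (C x rfl') (C x rfl')))
    e C d

/-- Path induction that varies the left end point. -/
def Jr {A : Exp} {y : El A} {C : (x : El A) → El (Id x y) → Exp} {x : El A} (p : El (Id x y))
    (d : El (C y rfl')) : El (C x p) :=
  ⟨ref .rightInd A y (lam A fun x => lam (idt 0 A x y) fun p => C ⟨x⟩ ⟨p⟩) d x p⟩

def leftUnitDef : El (Pi (U 0) fun X => Pi X fun x => Pi X fun y => Pi (Id x y) fun p =>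
    Id (rfl' (x := x) ⬝ p) p) :=
  Lam fun X => Lam fun x => Lam fun y => Lam fun p => by
    apply J p
    exact rfl'

def leftUnit {X : Exp} {x y : El X} (p : El (Id x y)) : El (Id (rfl' (x := x) ⬝ p) p) :=
  ⟨ref .leftUnit X x y p⟩

def assocDef : El (Pi (U 0) fun X => Pi X fun x => Pi X fun y => Pi X fun z => Pi X fun w =>
    Pi (Id x y) fun p => Pi (Id y z) fun q => Pi (Id z w) fun r => Id (p ⬝ q ⬝ r) (p ⬝ (q ⬝ r))) :=
  Lam fun X => Lam fun x => Lam fun y => Lam fun z => Lam fun w =>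
    Lam fun p => Lam fun q => Lam fun r => by
    apply J r
    exact rfl'

def assoc {X : Exp} {x y z w : El X} (p : El (Id x y)) (q : El (Id y z)) (r : El (Id z w)) :
    El (Id (p ⬝ q ⬝ r) (p ⬝ (q ⬝ r))) :=
  ⟨ref .assoc X x y z w p q r⟩

def cancelDef : El (Pi (U 0) fun X => Pi X fun x => Pi X fun y => Pi X fun z =>
    Pi (Id x y) fun p => Pi (Id x z) fun q => Id q (p ⬝ (inv p ⬝ q))) :=
  Lam fun X => Lam fun x => Lam fun y => Lam fun z => Lam fun p => Lam fun q => by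
    apply J q
    apply J p
    exact rfl'

def cancel {X : Exp} {x y z : El X} (p : El (Id x y)) (q : El (Id x z)) :
    El (Id q (p ⬝ (inv p ⬝ q))) :=
  ⟨ref .cancel X x y z p q⟩

/-- `ref` finds a definition by position, so these lists follow the order of `Label`, and the number
given to `Ctx.extend` counts the earlier definitions. A definition is transparent if later
conversions may compute with it, and sealed otherwise. -/
def pathDefs : List Def :=
  [symmDef.transparent, transDef.transparent, apDef.transparent, trDef.transparent,
    rightIndDef.transparent, leftUnitDef.transparent, assocDef.sealed, cancelDef.sealed]

def pathCtx : Ctx := Ctx.extend [] 0 pathDefs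

/-- The index of `El` guarantees nothing; the typing of the definitions is established here, by
evaluating the checker on them. -/
theorem realizable_pathCtx : pathCtx.Realizable :=
  Ctx.realizable_nil.extend (by decide +kernel)

/-! ### Zigzags of paths -/

/-- The six points are independent, so that path induction applies to every factor. With this
bracketing the composite computes to `rfl' ⬝ r` once the other four paths are `rfl'`. -/
def zigzagDef : El (Pi (U 0) fun X => Pi X fun x₀ => Pi X fun y₀ => Pi X fun x₁ => Pi X fun y₁ =>
    Pi X fun x₂ => Pi X fun y₂ => Pi (Id x₀ y₀) fun _ => Pi (Id x₁ y₀) fun _ =>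
    Pi (Id x₁ y₁) fun _ => Pi (Id x₂ y₁) fun _ => Pi (Id x₂ y₂) fun _ => Id x₀ y₂) :=
  Lam fun X => Lam fun x₀ => Lam fun y₀ => Lam fun x₁ => Lam fun y₁ => Lam fun x₂ => Lam fun y₂ =>
    Lam fun p => Lam fun q => Lam fun r => Lam fun s => Lam fun t => p ⬝ inv q ⬝ r ⬝ (inv s ⬝ t)

section

variable {X Y : Exp} {x₀ y₀ x₁ y₁ x₂ y₂ : El X}

/-- The composition of five paths of alternating directions. -/
def zigzag (p : El (Id x₀ y₀)) (q : El (Id x₁ y₀)) (r : El (Id x₁ y₁)) (s : El (Id x₂ y₁))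
    (t : El (Id x₂ y₂)) : El (Id x₀ y₂) :=
  ⟨ref .zigzag X x₀ y₀ x₁ y₁ x₂ y₂ p q r s t⟩

/-- The last two factors cancel against their inverses. This becomes the naturality square of the
first homotopy over `glue`. -/
def zigzagEtaDef : El (Pi (U 0) fun X => Pi X fun x₀ => Pi X fun y₀ => Pi X fun x₁ =>
    Pi X fun y₁ => Pi X fun x₂ => Pi X fun y₂ => Pi (Id x₀ y₀) fun p => Pi (Id x₁ y₀) fun q =>
    Pi (Id x₁ y₁) fun r => Pi (Id x₂ y₁) fun s => Pi (Id x₂ y₂) fun t =>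
    Id (zigzag p q r s t ⬝ (inv t ⬝ s)) (p ⬝ inv q ⬝ r)) :=
  Lam fun X => Lam fun x₀ => Lam fun y₀ => Lam fun x₁ => Lam fun y₁ => Lam fun x₂ => Lam fun y₂ =>
    Lam fun p => Lam fun q => Lam fun r => Lam fun s => Lam fun t => by
    apply J t
    apply Jr s
    exact rfl'

def zigzagEta (p : El (Id x₀ y₀)) (q : El (Id x₁ y₀)) (r : El (Id x₁ y₁)) (s : El (Id x₂ y₁))
    (t : El (Id x₂ y₂)) : El (Id (zigzag p q r s t ⬝ (inv t ⬝ s)) (p ⬝ inv q ⬝ r)) :=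
  ⟨ref .zigzagEta X x₀ y₀ x₁ y₁ x₂ y₂ p q r s t⟩

def apZigzagDef : El (Pi (U 0) fun X => Pi (U 0) fun Y => Pi (Arr X Y) fun f => Pi X fun x₀ =>
    Pi X fun y₀ => Pi X fun x₁ => Pi X fun y₁ => Pi X fun x₂ => Pi X fun y₂ =>
    Pi (Id x₀ y₀) fun p => Pi (Id x₁ y₀) fun q => Pi (Id x₁ y₁) fun r => Pi (Id x₂ y₁) fun s =>
    Pi (Id x₂ y₂) fun t => Id (ap' f (zigzag p q r s t))
      (zigzag (ap' f p) (ap' f q) (ap' f r) (ap' f s) (ap' f t))) :=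
  Lam fun X => Lam fun Y => Lam fun f => Lam fun x₀ => Lam fun y₀ => Lam fun x₁ => Lam fun y₁ =>
    Lam fun x₂ => Lam fun y₂ => Lam fun p => Lam fun q => Lam fun r => Lam fun s => Lam fun t => by
    -- Taken from the right, each path has an end that none of the remaining ones uses.
    apply J t
    apply Jr s
    apply J r
    apply Jr q
    apply J p
    exact rfl'

def apZigzag (f : El (Arr X Y)) (p : El (Id x₀ y₀)) (q : El (Id x₁ y₀)) (r : El (Id x₁ y₁))
    (s : El (Id x₂ y₁)) (t : El (Id x₂ y₂)) :
    El (Id (ap' f (zigzag p q r s t))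
      (zigzag (ap' f p) (ap' f q) (ap' f r) (ap' f s) (ap' f t))) :=
  ⟨ref .apZigzag X Y f x₀ y₀ x₁ y₁ x₂ y₂ p q r s t⟩

/-- Cancellation in p · q⁻¹ · q · p⁻¹ · p, the shape of the detour when its second coordinate is the
base point. -/
def zigzagLDef : El (Pi (U 0) fun X => Pi X fun x₀ => Pi X fun y₀ => Pi X fun x₁ =>
    Pi (Id x₀ y₀) fun p => Pi (Id x₁ y₀) fun q => Id (zigzag p q q p p) p) :=
  Lam fun X => Lam fun x₀ => Lam fun y₀ => Lam fun x₁ => Lam fun p => Lam fun q => by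
    apply Jr q
    apply J p
    exact rfl'

def zigzagL (p : El (Id x₀ y₀)) (q : El (Id x₁ y₀)) : El (Id (zigzag p q q p p) p) :=
  ⟨ref .zigzagL X x₀ y₀ x₁ p q⟩

/-- Cancellation in p · p⁻¹ · s · s⁻¹ · p, the shape of the detour when its first coordinate is the
base point. -/
def zigzagRDef : El (Pi (U 0) fun X => Pi X fun x₀ => Pi X fun y₀ => Pi X fun y₁ =>
    Pi (Id x₀ y₀) fun p => Pi (Id x₀ y₁) fun s => Id (zigzag p p s s p) p) :=
  Lam fun X => Lam fun x₀ => Lam fun y₀ => Lam fun y₁ => Lam fun p => Lam fun s => by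
    apply J s
    apply J p
    exact rfl'

def zigzagR (p : El (Id x₀ y₀)) (s : El (Id x₀ y₁)) : El (Id (zigzag p p s s p) p) :=
  ⟨ref .zigzagR X x₀ y₀ y₁ p s⟩

/-- Five equal paths can be cancelled in both ways, and the results agree. This is the coherence
that `smashPath` needs over push_lr. -/
def zigzagLRDef : El (Pi (U 0) fun X => Pi X fun x => Pi X fun y => Pi (Id x y) fun p =>
    Id (zigzagL p p) (zigzagR p p)) :=
  Lam fun X => Lam fun x => Lam fun y => Lam fun p => by
    apply J p
    exact rfl'

def zigzagLR (p : El (Id x₀ y₀)) : El (Id (zigzagL p p) (zigzagR p p)) :=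
  ⟨ref .zigzagLR X x₀ y₀ p⟩

/-- `r` has the same ends as `c` and stays quantified during the induction on `c`; for constant `c`
only the left unit law is left. -/
def zigzagMidDef : El (Pi (U 0) fun X => Pi X fun x => Pi X fun y => Pi (Id x y) fun c =>
    Pi (Id x y) fun r => Id (zigzag c c r c c) r) :=
  Lam fun X => Lam fun x => Lam fun y => Lam fun c => by
    apply J c
    exact Lam fun r => (leftUnit r).cast

def zigzagMid (c r : El (Id x₀ y₀)) : El (Id (zigzag c c r c c) r) :=
  ⟨ref .zigzagMid X x₀ y₀ c r⟩

def zigzagContractDef : El (Pi (U 0) fun X => Pi X fun x => Pi X fun y => Pi (Id x y) fun c =>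
    Pi (Id x y) fun p => Pi (Id p c) fun _ => Pi (Id x y) fun q => Pi (Id q c) fun _ =>
    Pi (Id x y) fun s => Pi (Id s c) fun _ => Pi (Id x y) fun r => Id (zigzag p q r s p) r) :=
  Lam fun X => Lam fun x => Lam fun y => Lam fun c => Lam fun p => Lam fun w => Lam fun q =>
    Lam fun u => Lam fun s => Lam fun v => Lam fun r => by
    apply Jr w
    apply Jr u
    apply Jr v
    exact zigzagMid c r

/-- A zigzag is equal to its middle path if the other four paths are equal. -/
def zigzagContract {c p q s : El (Id x₀ y₀)} (w : El (Id p c)) (u : El (Id q c)) (v : El (Id s c))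
    (r : El (Id x₀ y₀)) : El (Id (zigzag p q r s p) r) :=
  ⟨ref .zigzagContract X x₀ y₀ c p w q u s v r⟩

/-! ### Compatibility of the contractions of zigzags with maps and with each other. -/

def apZigzagLDef : El (Pi (U 0) fun X => Pi (U 0) fun Y => Pi (Arr X Y) fun f => Pi X fun x₀ =>
    Pi X fun y₀ => Pi X fun x₁ => Pi (Id x₀ y₀) fun p => Pi (Id x₁ y₀) fun q =>
    Id (cong (ap' f) (zigzagL p q)) (apZigzag f p q q p p ⬝ zigzagL (ap' f p) (ap' f q))) :=
  Lam fun X => Lam fun Y => Lam fun f => Lam fun x₀ => Lam fun y₀ => Lam fun x₁ => Lam fun p =>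
    Lam fun q => by
    apply Jr q
    apply J p
    exact rfl'

def apZigzagL (f : El (Arr X Y)) (p : El (Id x₀ y₀)) (q : El (Id x₁ y₀)) :
    El (Id (cong (ap' f) (zigzagL p q))
      (apZigzag f p q q p p ⬝ zigzagL (ap' f p) (ap' f q))) :=
  ⟨ref .apZigzagL X Y f x₀ y₀ x₁ p q⟩

def apZigzagRDef : El (Pi (U 0) fun X => Pi (U 0) fun Y => Pi (Arr X Y) fun f => Pi X fun x₀ =>
    Pi X fun y₀ => Pi X fun y₁ => Pi (Id x₀ y₀) fun p => Pi (Id x₀ y₁) fun s =>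
    Id (cong (ap' f) (zigzagR p s)) (apZigzag f p p s s p ⬝ zigzagR (ap' f p) (ap' f s))) :=
  Lam fun X => Lam fun Y => Lam fun f => Lam fun x₀ => Lam fun y₀ => Lam fun y₁ => Lam fun p =>
    Lam fun s => by
    apply J s
    apply J p
    exact rfl'

def apZigzagR (f : El (Arr X Y)) (p : El (Id x₀ y₀)) (s : El (Id x₀ y₁)) :
    El (Id (cong (ap' f) (zigzagR p s))
      (apZigzag f p p s s p ⬝ zigzagR (ap' f p) (ap' f s))) :=
  ⟨ref .apZigzagR X Y f x₀ y₀ y₁ p s⟩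

/-- The path `p` is contracted onto `c` by `w` at the two ends and by `v` in the fourth place, and
`e` reconciles the two. In the application `w` comes from push_l, `v` from push_r and `e` from
push_lr. -/
def contractLDef : El (Pi (U 0) fun X => Pi X fun x => Pi X fun y => Pi (Id x y) fun c =>
    Pi (Id x y) fun p => Pi (Id p c) fun w => Pi (Id p c) fun v => Pi (Id w v) fun _ =>
    Pi (Id x y) fun q => Pi (Id q c) fun u =>
    Id (zigzagL p q ⬝ w) (zigzagContract w u v q ⬝ u)) :=
  Lam fun X => Lam fun x => Lam fun y => Lam fun c => Lam fun p => Lam fun w => Lam fun v =>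
    Lam fun e => Lam fun q => Lam fun u => by
    apply J e
    apply Jr u
    apply Jr w
    apply J c
    exact rfl'

def contractL {c p : El (Id x₀ y₀)} {w v : El (Id p c)} (e : El (Id w v)) {q : El (Id x₀ y₀)}
    (u : El (Id q c)) : El (Id (zigzagL p q ⬝ w) (zigzagContract w u v q ⬝ u)) :=
  ⟨ref .contractL X x₀ y₀ c p w v e q u⟩

/-- Here `p` fills the first, second and fifth places and is contracted by `w` each time, so no two
contractions of it have to be compared. -/
def contractRDef : El (Pi (U 0) fun X => Pi X fun x => Pi X fun y => Pi (Id x y) fun c =>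
    Pi (Id x y) fun p => Pi (Id p c) fun w => Pi (Id x y) fun s => Pi (Id s c) fun v =>
    Id (zigzagR p s ⬝ w) (zigzagContract w w v s ⬝ v)) :=
  Lam fun X => Lam fun x => Lam fun y => Lam fun c => Lam fun p => Lam fun w => Lam fun s =>
    Lam fun v => by
    apply Jr v
    apply Jr w
    apply J c
    exact rfl'

def contractR {c p : El (Id x₀ y₀)} (w : El (Id p c)) {s : El (Id x₀ y₀)} (v : El (Id s c)) :
    El (Id (zigzagR p s ⬝ w) (zigzagContract w w v s ⬝ v)) :=
  ⟨ref .contractR X x₀ y₀ c p w s v⟩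

def pasteDef : El (Pi (U 0) fun X => Pi X fun x => Pi X fun y => Pi X fun z => Pi X fun t =>
    Pi X fun a => Pi X fun b => Pi (Id x z) fun p => Pi (Id x y) fun d => Pi (Id y z) fun l =>
    Pi (Id p (d ⬝ l)) fun _ => Pi (Id z t) fun w => Pi (Id y a) fun e => Pi (Id a b) fun β =>
    Pi (Id b t) fun m => Pi (Id (l ⬝ w) (e ⬝ (β ⬝ m))) fun _ =>
    Id (p ⬝ w) (d ⬝ (e ⬝ β) ⬝ m)) :=
  Lam fun X => Lam fun x => Lam fun y => Lam fun z => Lam fun t => Lam fun a => Lam fun b =>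
    Lam fun p => Lam fun d => Lam fun l => Lam fun h => Lam fun w => Lam fun e => Lam fun β =>
    Lam fun m => Lam fun k =>
      cong (fun i => i ⬝ w) h ⬝ assoc d l w ⬝ cong (fun i => d ⬝ i) k ⬝
        cong (fun i => d ⬝ i) (inv (assoc e β m)) ⬝ inv (assoc d (e ⬝ β) m)

/-- The composition of a triangle and a pentagon along `l`. -/
def paste {x y z t a b : El X} {p : El (Id x z)} {d : El (Id x y)} {l : El (Id y z)}
    (h : El (Id p (d ⬝ l))) {w : El (Id z t)} {e : El (Id y a)} {β : El (Id a b)} {m : El (Id b t)}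
    (k : El (Id (l ⬝ w) (e ⬝ (β ⬝ m)))) : El (Id (p ⬝ w) (d ⬝ (e ⬝ β) ⬝ m)) :=
  ⟨ref .paste X x y z t a b p d l h w e β m k⟩

end

def zigzagDefs : List Def :=
  [zigzagDef.transparent, zigzagEtaDef.sealed, apZigzagDef.transparent, zigzagLDef.transparent,
    zigzagRDef.transparent, zigzagLRDef.sealed, zigzagMidDef.transparent,
    zigzagContractDef.transparent, apZigzagLDef.sealed, apZigzagRDef.sealed, contractLDef.sealed,
    contractRDef.sealed, pasteDef.sealed]

def zigzagCtx : Ctx := pathCtx.extend 8 zigzagDefs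

theorem realizable_zigzagCtx : zigzagCtx.Realizable :=
  realizable_pathCtx.extend (by decide +kernel)

/-! ### Dependent paths -/

section

variable {X Y Z : Exp}

/-- The dependent action of `f : X → Y` on `p` is given by the path `q`. -/
def ConstRule {x y : El X} (f : El (Arr X Y)) (p : El (Id x y)) (q : El (Id (f x) (f y))) : Exp :=
  idt 0 (pathOver 0 0 X (lam X fun _ => Y) x y p (f x) (f y))
    (apd 0 0 X (lam X fun _ => Y) f x y p) (constOver 0 0 X Y x y p (f x) (f y) q)

/-- The computation rules of the eliminators speak of `apd` even in a constant family. At `rfl'`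
such a rule reads `rfl' = rfl' ⬝ q`, and `leftUnit` turns it into the claim about `ap'`. -/
def apdConstDef : El (Pi (U 0) fun X => Pi (U 0) fun Y => Pi (Arr X Y) fun f => Pi X fun x =>
    Pi X fun y => Pi (Id x y) fun p => Pi (Id (f x) (f y)) fun q => Pi (ConstRule f p q) fun _ =>
    Id (ap' f p) q) :=
  Lam fun X => Lam fun Y => Lam fun f => Lam fun x => Lam fun y => Lam fun p => by
    apply J p
    exact Lam fun q => Lam fun h => ((h.cast : El (Id rfl' (rfl' ⬝ q))) ⬝ leftUnit q).cast

def apdConst (f : El (Arr X Y)) {x y : El X} (p : El (Id x y)) (q : El (Id (f x) (f y)))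
    (h : El (ConstRule f p q)) : El (Id (ap' f p) q) :=
  ⟨ref .apdConst X Y f x y p q h⟩

/-- The dependent path in a constant family given by `q`. -/
def overConst {x y : El X} (p : El (Id x y)) {u v : El Y} (q : El (Id u v)) :
    El (Over (fun _ => Y) p u v) :=
  ⟨constOver 0 0 X Y x y p u v q⟩

/-- For `s` the path push_lr, this is the two-dimensional premise of the smash eliminator in a
constant family, with `h` as the coherence in `Y`. -/
def trConstDef : El (Pi (U 0) fun X => Pi (U 0) fun Y => Pi X fun x => Pi X fun y =>
    Pi (Id x y) fun p => Pi (Id x y) fun p' => Pi (Id p p') fun s => Pi Y fun u => Pi Y fun v =>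
    Pi (Id u v) fun q => Pi (Id u v) fun q' => Pi (Id q q') fun _ =>
    Over (fun p => Over (fun _ => Y) p u v) s (overConst p q) (overConst p' q')) :=
  Lam fun X => Lam fun Y => Lam fun x => Lam fun y => Lam fun p => Lam fun p' => Lam fun s =>
    Lam fun u => Lam fun v => Lam fun q => Lam fun q' => Lam fun h => by
    apply J h
    apply J s
    exact rfl'

def trConst {x y : El X} {p p' : El (Id x y)} (s : El (Id p p')) {u v : El Y} {q q' : El (Id u v)}
    (h : El (Id q q')) :
    El (Over (fun p => Over (fun _ => Y) p u v) s (overConst p q) (overConst p' q')) :=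
  ⟨ref .trConst X Y x y p p' s u v q q' h⟩

/-- A dependent path in a family of identity types is a naturality square; at `rfl'` the square says
`rfl' ⬝ v = u`. It is stated apart from `overSquare` because `ap'` of the identity function does not
compute to the path itself. -/
def overRetractDef : El (Pi (U 0) fun X => Pi (U 0) fun Y => Pi (Arr X Y) fun f =>
    Pi (Arr Y X) fun g => Pi X fun x => Pi X fun y => Pi (Id x y) fun p =>
    Pi (Id (g (f x)) x) fun u => Pi (Id (g (f y)) y) fun v =>
    Pi (Id (ap' g (ap' f p) ⬝ v) (u ⬝ p)) fun _ => Over (fun x => Id (g (f x)) x) p u v) :=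
  Lam fun X => Lam fun Y => Lam fun f => Lam fun g => Lam fun x => Lam fun y => Lam fun p => by
    apply J p
    exact Lam fun u => Lam fun v => Lam fun h =>
      (inv (h.cast : El (Id (rfl' ⬝ v) u)) ⬝ leftUnit v).cast

def overRetract (f : El (Arr X Y)) (g : El (Arr Y X)) {x y : El X} (p : El (Id x y))
    {u : El (Id (g (f x)) x)} {v : El (Id (g (f y)) y)}
    (h : El (Id (ap' g (ap' f p) ⬝ v) (u ⬝ p))) : El (Over (fun x => Id (g (f x)) x) p u v) :=
  ⟨ref .overRetract X Y f g x y p u v h⟩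

def overSquareDef : El (Pi (U 0) fun X => Pi (U 0) fun Y => Pi (U 0) fun Z =>
    Pi (Arr X Y) fun f => Pi (Arr Y Z) fun g => Pi (Arr X Z) fun k => Pi X fun x => Pi X fun y =>
    Pi (Id x y) fun p => Pi (Id (g (f x)) (k x)) fun u => Pi (Id (g (f y)) (k y)) fun v =>
    Pi (Id (ap' g (ap' f p) ⬝ v) (u ⬝ ap' k p)) fun _ =>
    Over (fun x => Id (g (f x)) (k x)) p u v) :=
  Lam fun X => Lam fun Y => Lam fun Z => Lam fun f => Lam fun g => Lam fun k => Lam fun x =>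
    Lam fun y => Lam fun p => by
    apply J p
    exact Lam fun u => Lam fun v => Lam fun h =>
      (inv (h.cast : El (Id (rfl' ⬝ v) u)) ⬝ leftUnit v).cast

def overSquare (f : El (Arr X Y)) (g : El (Arr Y Z)) (k : El (Arr X Z)) {x y : El X}
    (p : El (Id x y)) {u : El (Id (g (f x)) (k x))} {v : El (Id (g (f y)) (k y))}
    (h : El (Id (ap' g (ap' f p) ⬝ v) (u ⬝ ap' k p))) :
    El (Over (fun x => Id (g (f x)) (k x)) p u v) :=
  ⟨ref .overSquare X Y Z f g k x y p u v h⟩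

/-! ### Maps with a quasi-inverse are equivalences -/

def cancelSymmDef : El (Pi (U 0) fun X => Pi X fun x => Pi X fun y => Pi X fun z =>
    Pi (Id x y) fun p => Pi (Id x z) fun q => Id (p ⬝ inv (inv (inv p ⬝ q))) q) :=
  Lam fun X => Lam fun x => Lam fun y => Lam fun z => Lam fun p => Lam fun q => by
    apply J q
    apply J p
    exact rfl'

def cancelSymm {x y z : El X} (p : El (Id x y)) (q : El (Id x z)) :
    El (Id (p ⬝ inv (inv (inv p ⬝ q))) q) :=
  ⟨ref .cancelSymm X x y z p q⟩

/-- The homotopy fibre of `f` over `y`. -/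
def Fib (f : El (Arr X Y)) (y : El Y) : Exp := fib 0 X Y f y

/-- The point of a homotopy fibre given by `x` and `p`. -/
def fibMk (f : El (Arr X Y)) {y : El Y} (x : El X) (p : El (Id (f x) y)) : El (Fib f y) :=
  ⟨pair 0 X (fun x => idt 0 Y (f.exp x) y) x p⟩

def fibPathDef : El (Pi (U 0) fun X => Pi (U 0) fun Y => Pi (Arr X Y) fun f => Pi Y fun y =>
    Pi X fun x' => Pi X fun x => Pi (Id x' x) fun e => Pi (Id (f x') y) fun q =>
    Pi (Id (f x) y) fun p => Pi (Id q (ap' f e ⬝ p)) fun _ => Id (fibMk f x' q) (fibMk f x p)) :=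
  Lam fun X => Lam fun Y => Lam fun f => Lam fun y => Lam fun x' => Lam fun x => Lam fun e => by
    apply J e
    exact Lam fun q => Lam fun p => Lam fun h =>
      (cong (fun i => fibMk f x' i) ((h.cast : El (Id q (rfl' ⬝ p))) ⬝ leftUnit p))

def fibPath (f : El (Arr X Y)) {y : El Y} {x' x : El X} (e : El (Id x' x)) {q : El (Id (f x') y)}
    {p : El (Id (f x) y)} (h : El (Id q (ap' f e ⬝ p))) : El (Id (fibMk f x' q) (fibMk f x p)) :=
  ⟨ref .fibPath X Y f y x' x e q p h⟩

/-- Naturality of `ε` along `t`, with `inv t` appended so that both points lie in the fibre over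
`y`. -/
def centerPathDef : El (Pi (U 0) fun X => Pi (U 0) fun Y => Pi (Arr X Y) fun f =>
    Pi (Arr Y X) fun g => Pi (Pi Y fun y => Id (f (g y)) y) fun ε => Pi Y fun y => Pi Y fun y' =>
    Pi (Id y y') fun t => Id (fibMk f (g y) (ε y)) (fibMk f (g y') (ε y' ⬝ inv t))) :=
  Lam fun X => Lam fun Y => Lam fun f => Lam fun g => Lam fun ε => Lam fun y => Lam fun y' =>
    Lam fun t => by
    apply J t
    exact rfl'

def centerPath (f : El (Arr X Y)) (g : El (Arr Y X)) (ε : El (Pi Y fun y => Id (f (g y)) y))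
    {y y' : El Y} (t : El (Id y y')) :
    El (Id (fibMk f (g y) (ε y)) (fibMk f (g y') (ε y' ⬝ inv t))) :=
  ⟨ref .centerPath X Y f g ε y y' t⟩

/-- The contraction of a homotopy fibre onto its center `c`. -/
def fibInd (f : El (Arr X Y)) {y : El Y} (c : El (Fib f y))
    (d : (x : El X) → (p : El (Id (f x) y)) → El (Id c (fibMk f x p))) :
    El (Pi (Fib f y) fun w => Id c w) :=
  ⟨cst (.sigInd 0 0) X (lam X fun x => idt 0 Y (f.exp x) y)
    (lam (Fib f y) fun w => idt 0 (Fib f y) c w)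
    (lam X fun x => lam (idt 0 Y (f.exp x) y) fun p => (d ⟨x⟩ ⟨p⟩).exp)⟩

def contrMk {A : Exp} (c : El A) (d : El (Pi A fun x => Id c x)) : El (isContr 0 A) :=
  ⟨pair 0 A (fun c => pi A fun x => idt 0 A c x) c d⟩

def quasiInverseDef : El (Pi (U 0) fun X => Pi (U 0) fun Y => Pi (Arr X Y) fun f =>
    Pi (Arr Y X) fun g => Pi (Pi X fun x => Id (g (f x)) x) fun _ =>
    Pi (Pi Y fun y => Id (f (g y)) y) fun _ => Pi Y fun y => isContr 0 (Fib f y)) :=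
  Lam fun X => Lam fun Y => Lam fun f => Lam fun g => Lam fun η => Lam fun ε => Lam fun y =>
    contrMk (fibMk f (g y) (ε y)) (fibInd f _ fun x p =>
      -- The path from `y` to `f x` is the inverse of `p` corrected by the loop `inv (ε (f x)) ⬝ ap'
      -- f (η x)`. The correction absorbs the missing triangle law between `η` and `ε`: by
      -- `cancelSymm` the condition of `fibPath` holds.
      centerPath f g ε (inv (inv (ε (f x)) ⬝ (ap' f (η x) ⬝ p))) ⬝
        fibPath f (η x) (cancelSymm (ε (f x)) (ap' f (η x) ⬝ p)))

def quasiInverse (f : El (Arr X Y)) (g : El (Arr Y X)) (η : El (Pi X fun x => Id (g (f x)) x))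
    (ε : El (Pi Y fun y => Id (f (g y)) y)) : El (Pi Y fun y => isContr 0 (Fib f y)) :=
  ⟨ref .quasiInverse X Y f g η ε⟩

end

def equivDefs : List Def :=
  [apdConstDef.sealed, trConstDef.sealed, overRetractDef.sealed, overSquareDef.sealed,
    cancelSymmDef.sealed, fibPathDef.sealed, centerPathDef.sealed, quasiInverseDef.sealed]

def equivCtx : Ctx := zigzagCtx.extend 21 equivDefs

theorem realizable_equivCtx : equivCtx.Realizable :=
  realizable_zigzagCtx.extend (by decide +kernel)

/-! ### Pairs -/

section

variable {A B : Exp}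

/-- The pair of `x` and `y`. -/
def pairMk (x : El A) (y : El B) : El (prod 0 A B) := ⟨mk 0 A B x y⟩

/-- Induction on pairs. -/
def pairInd (P : El (prod 0 A B) → Exp) (d : (x : El A) → (y : El B) → El (P (pairMk x y))) :
    El (Pi (prod 0 A B) P) :=
  ⟨cst (.sigInd 0 0) A (lam A fun _ => B) (lam (prod 0 A B) fun p => P ⟨p⟩)
    (lam A fun x => lam B fun y => (d ⟨x⟩ ⟨y⟩).exp)⟩

end

/-! ### Suspensions and smash products -/

section

variable {A B : Exp} (a : El A) (b : El B)

def northEl {C : Exp} : El (susp 0 C) := ⟨north 0 C⟩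

def southEl {C : Exp} : El (susp 0 C) := ⟨south 0 C⟩

def meridEl {C : Exp} (c : El C) : El (Id (northEl : El (susp 0 C)) southEl) := ⟨merid 0 C c⟩

/-- The smash product of `A` and `B` with the base points `a` and `b`. -/
def Smash (a : El A) (b : El B) : Exp := smash 0 A a B b

def smashBase : El (Smash a b) := ⟨smashPt 0 A a B b⟩

end

def smashPairDef : El (Pi (U 0) fun A => Pi A fun a => Pi (U 0) fun B => Pi B fun b =>
    Pi A fun _ => Pi B fun _ => Smash a b) :=
  Lam fun A => Lam fun a => Lam fun B => Lam fun b => Lam fun x => Lam fun y =>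
    ⟨smashMk 0 A a B b (mk 0 A B x y)⟩

section

variable {A B : Exp} (a : El A) (b : El B)

/-- The point of the smash product given by `x` and `y`. -/
def smashPair (x : El A) (y : El B) : El (Smash a b) := ⟨ref .smashPair A a B b x y⟩

/-- The path from `⟨x, b⟩` to the base point. -/
def smashPushL (x : El A) : El (Id (smashPair a b x b) (smashBase a b)) := ⟨smashL 0 A a B b x⟩

/-- The path from `⟨a, y⟩` to the base point. -/
def smashPushR (y : El B) : El (Id (smashPair a b a y) (smashBase a b)) := ⟨smashR 0 A a B b y⟩

/-- The two paths from `⟨a, b⟩` to the base point are equal. -/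
def smashPushLR : El (Id (smashPushL a b a) (smashPushR a b b)) := ⟨smashLR 0 A a B b⟩

end

/-- The suspension of the smash product. -/
abbrev SuspSmash {A B : Exp} (a : El A) (b : El B) : Exp := susp 0 (Smash a b)

/-! ### Maps out of suspensions and smash products -/

def smashIndWeakDef : El (Pi (U 0) fun A => Pi A fun a => Pi (U 0) fun B => Pi B fun b =>
    Pi (Arr (Smash a b) (U 0)) fun P => Pi (P (smashBase a b)) fun z =>
    Pi (Pi A fun x => Pi B fun y => P (smashPair a b x y)) fun k =>
    Pi (Pi A fun x => Over (fun s => P s) (smashPushL a b x) (k x b) z) fun _ =>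
    Pi (Pi B fun y => Over (fun s => P s) (smashPushR a b y) (k a y) z) fun _ =>
    Pi (Smash a b) fun s => P s) :=
  Lam fun A => Lam fun a => Lam fun B => Lam fun b => Lam fun P => Lam fun z => Lam fun k =>
    Lam fun l => Lam fun r =>
    -- `l'` is `l a` moved along push_lr to a dependent path over push_r at `b`. Following `r` by
    -- the loop `inv (r b) ⬝ l'` at `z` makes its value at `b` equal to `l'`, by `cancel`.
    let l' := tr (fun q => Over (fun s => P s) q (k a b) z) (smashPushLR a b) (l a)
    ⟨cst (.smashInd 0 0) A a B b P z
      (pairInd (fun p => P ⟨smashMk 0 A a B b p⟩) fun x y => (k x y).cast) l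
      (Lam fun y => r y ⬝ (inv (r b) ⬝ l')) (cancel (r b) l')⟩

def smashIndDefs : List Def :=
  [smashPairDef.transparent, smashIndWeakDef.sealed]

def smashIndCtx : Ctx := equivCtx.extend 29 smashIndDefs

theorem realizable_smashIndCtx : smashIndCtx.Realizable :=
  realizable_equivCtx.extend (by decide +kernel)

/-- Induction on smash products. No coherence of `l` with `r` is needed, because composing `r` with
a loop at `z` achieves it. -/
def smashIndWeak {A B : Exp} {a : El A} {b : El B} (P : El (Smash a b) → Exp)
    (z : El (P (smashBase a b))) (k : (x : El A) → (y : El B) → El (P (smashPair a b x y)))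
    (l : (x : El A) → El (Over P (smashPushL a b x) (k x b) z))
    (r : (y : El B) → El (Over P (smashPushR a b y) (k a y) z)) :
    El (Pi (Smash a b) P) :=
  ⟨ref .smashIndWeak A a B b (lam (Smash a b) fun s => P ⟨s⟩) z
    (Lam fun x => Lam fun y => k x y) (Lam l) (Lam r)⟩

section

variable {A B Y : Exp} (a : El A) (b : El B) {z : El Y} {k : El (Pi A fun _ => Pi B fun _ => Y)}
  (l : El (Pi A fun x => Id (k x b) z)) (r : El (Pi B fun y => Id (k a y) z))
  (h : El (Id (l a) (r b).cast))

/-- An eliminator or computation rule of smash products, in the case of a constant family. -/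
def smashRule (c : Const) : Exp :=
  cst c A a B b (lam (Smash a b) fun _ => Y) z
    (lam (prod 0 A B) fun p => k (⟨fst 0 A B p⟩ : El A) (⟨snd 0 A B p⟩ : El B))
    (lam A fun x => overConst (smashPushL a b ⟨x⟩) (l ⟨x⟩))
    (lam B fun y => overConst (smashPushR a b ⟨y⟩) (r ⟨y⟩))
    (trConst (smashPushLR a b) (q := l a) (q' := (r b).cast) h)

end

def smashRecDef : El (Pi (U 0) fun A => Pi A fun a => Pi (U 0) fun B => Pi B fun b =>
    Pi (U 0) fun Y => Pi Y fun z => Pi (Pi A fun _ => Pi B fun _ => Y) fun k =>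
    Pi (Pi A fun x => Id (k x b) z) fun l => Pi (Pi B fun y => Id (k a y) z) fun r =>
    Pi (Id (l a) (r b).cast) fun h => Arr (Smash a b) Y) :=
  Lam fun A => Lam fun a => Lam fun B => Lam fun b => Lam fun Y => Lam fun z => Lam fun k =>
    Lam fun l => Lam fun r => Lam fun h => ⟨smashRule a b l r h (.smashInd 0 0)⟩

section

variable {A B Y : Exp} (a : El A) (b : El B) {z : El Y} {k : El (Pi A fun _ => Pi B fun _ => Y)}
  (l : El (Pi A fun x => Id (k x b) z)) (r : El (Pi B fun y => Id (k a y) z))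
  (h : El (Id (l a) (r b).cast))

/-- The map out of the smash product given by `z`, `k`, `l`, `r` and `h`. -/
def smashRec : El (Arr (Smash a b) Y) := ⟨ref .smashRec A a B b Y z k l r h⟩

end

def smashRecLDef : El (Pi (U 0) fun A => Pi A fun a => Pi (U 0) fun B => Pi B fun b =>
    Pi (U 0) fun Y => Pi Y fun z => Pi (Pi A fun _ => Pi B fun _ => Y) fun k =>
    Pi (Pi A fun x => Id (k x b) z) fun l => Pi (Pi B fun y => Id (k a y) z) fun r =>
    Pi (Id (l a) (r b).cast) fun h => Pi A fun x =>
    Id (ap' (smashRec a b l r h) (smashPushL a b x)) (l x).cast) :=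
  Lam fun A => Lam fun a => Lam fun B => Lam fun b => Lam fun Y => Lam fun z => Lam fun k =>
    Lam fun l => Lam fun r => Lam fun h => Lam fun x =>
    apdConst (smashRec a b l r h) (smashPushL a b x) (l x).cast
      ⟨smashRule a b l r h (.smashBetaL 0 0) x⟩

def smashRecDefs : List Def :=
  [smashRecDef.transparent, smashRecLDef.sealed]

def smashRecCtx : Ctx := smashIndCtx.extend 31 smashRecDefs

theorem realizable_smashRecCtx : smashRecCtx.Realizable :=
  realizable_smashIndCtx.extend (by decide +kernel)

def smashRecRDef : El (Pi (U 0) fun A => Pi A fun a => Pi (U 0) fun B => Pi B fun b =>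
    Pi (U 0) fun Y => Pi Y fun z => Pi (Pi A fun _ => Pi B fun _ => Y) fun k =>
    Pi (Pi A fun x => Id (k x b) z) fun l => Pi (Pi B fun y => Id (k a y) z) fun r =>
    Pi (Id (l a) (r b).cast) fun h => Pi B fun y =>
    Id (ap' (smashRec a b l r h) (smashPushR a b y)) (r y).cast) :=
  Lam fun A => Lam fun a => Lam fun B => Lam fun b => Lam fun Y => Lam fun z => Lam fun k =>
    Lam fun l => Lam fun r => Lam fun h => Lam fun y =>
    apdConst (smashRec a b l r h) (smashPushR a b y) (r y).cast
      ⟨smashRule a b l r h (.smashBetaR 0 0) y⟩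

def smashRecRDefs : List Def :=
  [smashRecRDef.sealed]

def smashRecRCtx : Ctx := smashRecCtx.extend 33 smashRecRDefs

theorem realizable_smashRecRCtx : smashRecRCtx.Realizable :=
  realizable_smashRecCtx.extend (by decide +kernel)

section

variable {A B Y : Exp} (a : El A) (b : El B) {z : El Y} {k : El (Pi A fun _ => Pi B fun _ => Y)}
  (l : El (Pi A fun x => Id (k x b) z)) (r : El (Pi B fun y => Id (k a y) z))
  (h : El (Id (l a) (r b).cast))

def smashRecL (x : El A) : El (Id (ap' (smashRec a b l r h) (smashPushL a b x)) (l x).cast) :=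
  ⟨ref .smashRecL A a B b Y z k l r h x⟩

def smashRecR (y : El B) : El (Id (ap' (smashRec a b l r h) (smashPushR a b y)) (r y).cast) :=
  ⟨ref .smashRecR A a B b Y z k l r h y⟩

/-- An eliminator or computation rule of suspensions, in the case of a constant family. -/
def suspRule {C : Exp} {n s : El Y} (m : El (Arr C (Id n s))) (c : Const) : Exp :=
  cst c C (lam (susp 0 C) fun _ => Y) n s
    (lam C fun i => overConst (meridEl (⟨i⟩ : El C)) (m ⟨i⟩))

end

def suspRecDef : El (Pi (U 0) fun C => Pi (U 0) fun Y => Pi Y fun n => Pi Y fun s =>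
    Pi (Arr C (Id n s)) fun m => Arr (susp 0 C) Y) :=
  Lam fun C => Lam fun Y => Lam fun n => Lam fun s => Lam fun m => ⟨suspRule m (.suspInd 0 0)⟩

/-- The map out of a suspension given by `m`. -/
def suspRec {C Y : Exp} {n s : El Y} (m : El (Arr C (Id n s))) : El (Arr (susp 0 C) Y) :=
  ⟨ref .suspRec C Y n s m⟩

def suspRecMeridDef : El (Pi (U 0) fun C => Pi (U 0) fun Y => Pi Y fun n => Pi Y fun s =>
    Pi (Arr C (Id n s)) fun m => Pi C fun c => Id (ap' (suspRec m) (meridEl c)) (m c).cast) :=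
  Lam fun C => Lam fun Y => Lam fun n => Lam fun s => Lam fun m => Lam fun c =>
    apdConst (suspRec m) (meridEl c) (m c).cast ⟨suspRule m (.suspBeta 0 0) c⟩

def suspRecDefs : List Def :=
  [suspRecDef.transparent, suspRecMeridDef.sealed]

def suspRecCtx : Ctx := smashRecRCtx.extend 34 suspRecDefs

theorem realizable_suspRecCtx : suspRecCtx.Realizable :=
  realizable_smashRecRCtx.extend (by decide +kernel)

def suspRecMerid {C Y : Exp} {n s : El Y} (m : El (Arr C (Id n s))) (c : El C) :
    El (Id (ap' (suspRec m) (meridEl c)) (m c).cast) :=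
  ⟨ref .suspRecMerid C Y n s m c⟩

/-! ### The join -/

def joinDef : El (Pi (U 0) fun A => Pi (U 0) fun B => U 0) :=
  Lam fun A => Lam fun B => ⟨HoTT.join 0 A B⟩

/-- The join of `A` and `B`. -/
def Join (A B : Exp) : Exp := ref .join A B

def joinLDef : El (Pi (U 0) fun A => Pi (U 0) fun B => Pi A fun _ => Join A B) :=
  Lam fun A => Lam fun B => Lam fun x => ⟨HoTT.inl 0 (prod 0 A B) A B (fst 0 A B) (snd 0 A B) x⟩

def joinRDef : El (Pi (U 0) fun A => Pi (U 0) fun B => Pi B fun _ => Join A B) :=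
  Lam fun A => Lam fun B => Lam fun y => ⟨HoTT.inr 0 (prod 0 A B) A B (fst 0 A B) (snd 0 A B) y⟩

section

variable {A B : Exp}

/-- The inclusion of the left factor in the join. -/
def joinL (x : El A) : El (Join A B) := ⟨ref .joinL A B x⟩

/-- The inclusion of the right factor in the join. -/
def joinR (y : El B) : El (Join A B) := ⟨ref .joinR A B y⟩

def glueDef : El (Pi (U 0) fun A => Pi (U 0) fun B => Pi A fun x => Pi B fun y =>
    Id (joinL x : El (Join A B)) (joinR y)) :=
  Lam fun A => Lam fun B => Lam fun x => Lam fun y =>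
    ⟨push 0 (prod 0 A B) A B (fst 0 A B) (snd 0 A B) (mk 0 A B x y)⟩

/-- The path in the join given by `x` and `y`. -/
def glue (x : El A) (y : El B) : El (Id (joinL x : El (Join A B)) (joinR y)) :=
  ⟨ref .glue A B x y⟩

end

/-! ### The pinch map -/

def pinchDef : El (Pi (U 0) fun A => Pi A fun a => Pi (U 0) fun B => Pi B fun b =>
    Arr (Join A B) (SuspSmash a b)) :=
  Lam fun A => Lam fun a => Lam fun B => Lam fun b => ⟨HoTT.pinch 0 A a B b⟩

/-- The pinch map. -/
def pinchEl {A B : Exp} (a : El A) (b : El B) : El (Arr (Join A B) (SuspSmash a b)) :=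
  ⟨ref .pinch A a B b⟩

/-- The paths in the join from the left to the right factor. -/
abbrev JoinPath {A B : Exp} (x : El A) (y : El B) : Exp := Id (joinL x : El (Join A B)) (joinR y)

/-- The paths in the suspension between the poles. -/
abbrev PolePath {A B : Exp} (a : El A) (b : El B) : Exp :=
  Id (northEl : El (SuspSmash a b)) southEl

/-- `pinch` computes on both inclusions, so for all `x` and `y` the image of a path from `inl x` to
`inr y` runs from `north` to `south`. This common type allows the images to be compared. -/
def apPinchDef : El (Pi (U 0) fun A => Pi A fun a => Pi (U 0) fun B => Pi B fun b =>
    Pi A fun x => Pi B fun y => Arr (JoinPath x y) (PolePath a b)) :=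
  Lam fun A => Lam fun a => Lam fun B => Lam fun b => Lam fun x => Lam fun y => Lam fun p =>
    (ap' (pinchEl a b) p).cast

def pinchDefs : List Def :=
  [joinDef.transparent, joinLDef.transparent, joinRDef.transparent, glueDef.transparent,
    pinchDef.transparent, apPinchDef.transparent]

def pinchCtx : Ctx := suspRecCtx.extend 36 pinchDefs

theorem realizable_pinchCtx : pinchCtx.Realizable :=
  realizable_suspRecCtx.extend (by decide +kernel)

/-- The action of the pinch map on the paths between the two factors. -/
def apPinch {A B : Exp} (a : El A) (b : El B) {x : El A} {y : El B} (p : El (JoinPath x y)) :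
    El (PolePath a b) :=
  ⟨ref .apPinch A a B b x y p⟩

def pinchGlueDef : El (Pi (U 0) fun A => Pi A fun a => Pi (U 0) fun B => Pi B fun b =>
    Pi A fun x => Pi B fun y => Id (apPinch a b (glue x y)) (meridEl (smashPair a b x y))) :=
  Lam fun A => Lam fun a => Lam fun B => Lam fun b => Lam fun x => Lam fun y =>
    let S := smash 0 A a B b
    (apdConst (pinchEl a b) (glue x y) (meridEl (smashPair a b x y)).cast
      ⟨cst (.pushoutBeta 0 0) (prod 0 A B) A B (fst 0 A B) (snd 0 A B)
        (lam (HoTT.join 0 A B) fun _ => susp 0 S) (lam A fun _ => north 0 S)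
        (lam B fun _ => south 0 S)
        (lam (prod 0 A B) fun p => constOver 0 0 (HoTT.join 0 A B) (susp 0 S)
          (inl 0 (prod 0 A B) A B (fst 0 A B) (snd 0 A B) (fst 0 A B p))
          (inr 0 (prod 0 A B) A B (fst 0 A B) (snd 0 A B) (snd 0 A B p))
          (push 0 (prod 0 A B) A B (fst 0 A B) (snd 0 A B) p)
          (north 0 S) (south 0 S) (merid 0 S (smashMk 0 A a B b p)))
        (mk 0 A B x y)⟩).cast

def pinchGlueDefs : List Def :=
  [pinchGlueDef.sealed]

def pinchGlueCtx : Ctx := pinchCtx.extend 42 pinchGlueDefs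

theorem realizable_pinchGlueCtx : pinchGlueCtx.Realizable :=
  realizable_pinchCtx.extend (by decide +kernel)

def pinchGlue {A B : Exp} (a : El A) (b : El B) (x : El A) (y : El B) :
    El (Id (apPinch a b (glue x y)) (meridEl (smashPair a b x y))) :=
  ⟨ref .pinchGlue A a B b x y⟩

/-! ### The inverse of the pinch map -/

def detourDef : El (Pi (U 0) fun A => Pi A fun a => Pi (U 0) fun B => Pi B fun b =>
    Pi A fun x => Pi B fun y => JoinPath a b) :=
  Lam fun A => Lam fun a => Lam fun B => Lam fun b => Lam fun x => Lam fun y =>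
    zigzag (glue a b) (glue x b) (glue x y) (glue a y) (glue a b)

/-- The path between the base points of the join that passes through `x` and `y`. -/
def detour {A B : Exp} (a : El A) (b : El B) (x : El A) (y : El B) :
    El (JoinPath a b) :=
  ⟨ref .detour A a B b x y⟩

def detourLDef : El (Pi (U 0) fun A => Pi A fun a => Pi (U 0) fun B => Pi B fun b =>
    Pi A fun x => Id (detour a b x b) (glue a b)) :=
  Lam fun A => Lam fun a => Lam fun B => Lam fun b => Lam fun x =>
    (zigzagL (glue a b) (glue x b)).cast

def detourL {A B : Exp} (a : El A) (b : El B) (x : El A) :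
    El (Id (detour a b x b) (glue a b)) :=
  ⟨ref .detourL A a B b x⟩

def detourRDef : El (Pi (U 0) fun A => Pi A fun a => Pi (U 0) fun B => Pi B fun b =>
    Pi B fun y => Id (detour a b a y) (glue a b)) :=
  Lam fun A => Lam fun a => Lam fun B => Lam fun b => Lam fun y =>
    (zigzagR (glue a b) (glue a y)).cast

def detourR {A B : Exp} (a : El A) (b : El B) (y : El B) :
    El (Id (detour a b a y) (glue a b)) :=
  ⟨ref .detourR A a B b y⟩

def detourLRDef : El (Pi (U 0) fun A => Pi A fun a => Pi (U 0) fun B => Pi B fun b =>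
    Id (detourL a b a) (detourR a b b)) :=
  Lam fun A => Lam fun a => Lam fun B => Lam fun b =>
    (zigzagLR (glue a b)).cast

def detourLR {A B : Exp} (a : El A) (b : El B) :
    El (Id (detourL a b a) (detourR a b b)) :=
  ⟨ref .detourLR A a B b⟩

def smashPathDef : El (Pi (U 0) fun A => Pi A fun a => Pi (U 0) fun B => Pi B fun b =>
    Arr (Smash a b) (JoinPath a b)) :=
  Lam fun A => Lam fun a => Lam fun B => Lam fun b =>
    smashRec a b (z := glue a b) (k := Lam fun x => Lam fun y => detour a b x y)
      (Lam fun x => (detourL a b x).cast) (Lam fun y => (detourR a b y).cast) (detourLR a b).cast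

/-- The map from the smash product to the paths in the join. -/
def smashPath {A B : Exp} (a : El A) (b : El B) :
    El (Arr (Smash a b) (JoinPath a b)) :=
  ⟨ref .smashPath A a B b⟩

def smashPathLDef : El (Pi (U 0) fun A => Pi A fun a => Pi (U 0) fun B => Pi B fun b =>
    Pi A fun x => Id (ap' (smashPath a b) (smashPushL a b x)) (detourL a b x).cast) :=
  Lam fun A => Lam fun a => Lam fun B => Lam fun b => Lam fun x =>
    (smashRecL a b (z := glue a b) (k := Lam fun x => Lam fun y => detour a b x y)
      (Lam fun x => (detourL a b x).cast) (Lam fun y => (detourR a b y).cast)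
      (detourLR a b).cast x).cast

def smashPathL {A B : Exp} (a : El A) (b : El B) (x : El A) :
    El (Id (ap' (smashPath a b) (smashPushL a b x)) (detourL a b x).cast) :=
  ⟨ref .smashPathL A a B b x⟩

def smashPathRDef : El (Pi (U 0) fun A => Pi A fun a => Pi (U 0) fun B => Pi B fun b =>
    Pi B fun y => Id (ap' (smashPath a b) (smashPushR a b y)) (detourR a b y).cast) :=
  Lam fun A => Lam fun a => Lam fun B => Lam fun b => Lam fun y =>
    (smashRecR a b (z := glue a b) (k := Lam fun x => Lam fun y => detour a b x y)
      (Lam fun x => (detourL a b x).cast) (Lam fun y => (detourR a b y).cast)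
      (detourLR a b).cast y).cast

def smashPathDefs : List Def :=
  [detourDef.transparent, detourLDef.transparent, detourRDef.transparent,
    detourLRDef.transparent, smashPathDef.transparent, smashPathLDef.sealed,
    smashPathRDef.sealed]

def smashPathCtx : Ctx := pinchGlueCtx.extend 43 smashPathDefs

theorem realizable_smashPathCtx : smashPathCtx.Realizable :=
  realizable_pinchGlueCtx.extend (by decide +kernel)

def smashPathR {A B : Exp} (a : El A) (b : El B) (y : El B) :
    El (Id (ap' (smashPath a b) (smashPushR a b y)) (detourR a b y).cast) :=
  ⟨ref .smashPathR A a B b y⟩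

def unpinchDef : El (Pi (U 0) fun A => Pi A fun a => Pi (U 0) fun B => Pi B fun b =>
    Arr (SuspSmash a b) (Join A B)) :=
  Lam fun A => Lam fun a => Lam fun B => Lam fun b =>
    suspRec (smashPath a b)

/-- The inverse of the pinch map. -/
def unpinch {A B : Exp} (a : El A) (b : El B) :
    El (Arr (SuspSmash a b) (Join A B)) :=
  ⟨ref .unpinch A a B b⟩

def apUnpinchDef : El (Pi (U 0) fun A => Pi A fun a => Pi (U 0) fun B => Pi B fun b =>
    Pi (PolePath a b) fun p => JoinPath a b) :=
  Lam fun A => Lam fun a => Lam fun B => Lam fun b => Lam fun p =>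
    (ap' (unpinch a b) p).cast

/-- The action of the inverse of the pinch map on the paths between the poles. -/
def apUnpinch {A B : Exp} (a : El A) (b : El B) (p : El (PolePath a b)) :
    El (JoinPath a b) :=
  ⟨ref .apUnpinch A a B b p⟩

def unpinchMeridDef : El (Pi (U 0) fun A => Pi A fun a => Pi (U 0) fun B => Pi B fun b =>
    Pi (Smash a b) fun s => Id (apUnpinch a b (meridEl s)) (smashPath a b s)) :=
  Lam fun A => Lam fun a => Lam fun B => Lam fun b => Lam fun s =>
    (suspRecMerid (smashPath a b) s).cast

def unpinchMerid {A B : Exp} (a : El A) (b : El B) (s : El (Smash a b)) :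
    El (Id (apUnpinch a b (meridEl s)) (smashPath a b s)) :=
  ⟨ref .unpinchMerid A a B b s⟩

/-! ### The first homotopy -/

/-- `unpinch (pinch (inl x))` computes to `inl a`, which is connected to `inl x` through `inr b`. -/
def retractionLDef : El (Pi (U 0) fun A => Pi A fun a => Pi (U 0) fun B => Pi B fun b =>
    Pi A fun x => Id (joinL a : El (Join A B)) (joinL x)) :=
  Lam fun A => Lam fun a => Lam fun B => Lam fun b => Lam fun x =>
    glue a b ⬝ inv (glue x b)

def retractionL {A B : Exp} (a : El A) (b : El B) (x : El A) :
    El (Id (joinL a : El (Join A B)) (joinL x)) :=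
  ⟨ref .retractionL A a B b x⟩

def retractionRDef : El (Pi (U 0) fun A => Pi A fun a => Pi (U 0) fun B => Pi B fun b =>
    Pi B fun y => Id (joinR b : El (Join A B)) (joinR y)) :=
  Lam fun A => Lam fun a => Lam fun B => Lam fun b => Lam fun y =>
    inv (glue a b) ⬝ glue a y

def retractionR {A B : Exp} (a : El A) (b : El B) (y : El B) :
    El (Id (joinR b : El (Join A B)) (joinR y)) :=
  ⟨ref .retractionR A a B b y⟩

/-- The left side becomes the detour followed by push(a,b)⁻¹ · push(a,y), which cancels the last two
factors of the detour. -/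
def retractionGlueDef : El (Pi (U 0) fun A => Pi A fun a => Pi (U 0) fun B => Pi B fun b =>
    Pi A fun x => Pi B fun y => Id (apUnpinch a b (apPinch a b (glue x y)) ⬝ retractionR a b y)
      (retractionL a b x ⬝ glue x y)) :=
  Lam fun A => Lam fun a => Lam fun B => Lam fun b => Lam fun x => Lam fun y =>
    cong (fun i => i ⬝ retractionR a b y)
      (cong (fun i => apUnpinch a b i) (pinchGlue a b x y) ⬝
        unpinchMerid a b (smashPair a b x y)) ⬝
      (zigzagEta (glue a b) (glue x b) (glue x y) (glue a y) (glue a b)).cast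

def retractionGlue {A B : Exp} (a : El A) (b : El B) (x : El A) (y : El B) :
    El (Id (apUnpinch a b (apPinch a b (glue x y)) ⬝ retractionR a b y)
      (retractionL a b x ⬝ glue x y)) :=
  ⟨ref .retractionGlue A a B b x y⟩

def retractionDef : El (Pi (U 0) fun A => Pi A fun a => Pi (U 0) fun B => Pi B fun b =>
    Pi (Join A B) fun x => Id (unpinch a b (pinchEl a b x)) x) :=
  Lam fun A => Lam fun a => Lam fun B => Lam fun b =>
    let P : Exp := lam (Join A B) fun x => idt 0 (Join A B) (unpinch a b (pinchEl a b ⟨x⟩)) x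
    let l : Exp := lam A fun x => retractionL a b ⟨x⟩
    let r : Exp := lam B fun y => retractionR a b ⟨y⟩
    ⟨cst (.pushoutInd 0 0) (prod 0 A B) A B (fst 0 A B) (snd 0 A B) P l r
      (pairInd (fun p => pushOver 0 0 (prod 0 A B) A B (fst 0 A B) (snd 0 A B) P l r p) fun x y =>
        (overRetract (pinchEl a b) (unpinch a b) (glue x y) (u := (retractionL a b x).cast)
          (v := (retractionR a b y).cast) (retractionGlue a b x y).cast).cast)⟩

def retractionDefs : List Def :=
  [unpinchDef.transparent, apUnpinchDef.transparent, unpinchMeridDef.sealed,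
    retractionLDef.transparent, retractionRDef.transparent, retractionGlueDef.sealed,
    retractionDef.sealed]

def retractionCtx : Ctx := smashPathCtx.extend 50 retractionDefs

theorem realizable_retractionCtx : retractionCtx.Realizable :=
  realizable_smashPathCtx.extend (by decide +kernel)

def retraction {A B : Exp} (a : El A) (b : El B) :
    El (Pi (Join A B) fun x => Id (unpinch a b (pinchEl a b x)) x) :=
  ⟨ref .retraction A a B b⟩

/-! ### The second homotopy -/

def meridLDef : El (Pi (U 0) fun A => Pi A fun a => Pi (U 0) fun B => Pi B fun b =>
    Pi A fun x => Id (apPinch a b (glue x b)) (meridEl (smashBase a b))) :=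
  Lam fun A => Lam fun a => Lam fun B => Lam fun b => Lam fun x =>
    pinchGlue a b x b ⬝ cong meridEl (smashPushL a b x)

def meridL {A B : Exp} (a : El A) (b : El B) (x : El A) :
    El (Id (apPinch a b (glue x b)) (meridEl (smashBase a b))) :=
  ⟨ref .meridL A a B b x⟩

def meridRDef : El (Pi (U 0) fun A => Pi A fun a => Pi (U 0) fun B => Pi B fun b =>
    Pi B fun y => Id (apPinch a b (glue a y)) (meridEl (smashBase a b))) :=
  Lam fun A => Lam fun a => Lam fun B => Lam fun b => Lam fun y =>
    pinchGlue a b a y ⬝ cong meridEl (smashPushR a b y)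

def meridR {A B : Exp} (a : El A) (b : El B) (y : El B) :
    El (Id (apPinch a b (glue a y)) (meridEl (smashBase a b))) :=
  ⟨ref .meridR A a B b y⟩

def meridLRDef : El (Pi (U 0) fun A => Pi A fun a => Pi (U 0) fun B => Pi B fun b =>
    Id (meridL a b a) (meridR a b b)) :=
  Lam fun A => Lam fun a => Lam fun B => Lam fun b =>
    (cong (fun i => pinchGlue a b a b ⬝ cong meridEl i) (smashPushLR a b)).cast

def meridLR {A B : Exp} (a : El A) (b : El B) :
    El (Id (meridL a b a) (meridR a b b)) :=
  ⟨ref .meridLR A a B b⟩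

/-- The statement that the pinch map sends the path given by `s` to the meridian of `s`. -/
def ApPinchPath {A B : Exp} (a : El A) (b : El B) (s : El (Smash a b)) : Exp :=
  Id (apPinch a b (smashPath a b s)) (meridEl s)

/-! ### The action of the pinch map on detours. -/

def apPinchZigzagDef : El (Pi (U 0) fun A => Pi A fun a => Pi (U 0) fun B => Pi B fun b =>
    Pi A fun x => Pi B fun y => Id (apPinch a b (detour a b x y))
      (zigzag (apPinch a b (glue a b)) (apPinch a b (glue x b)) (apPinch a b (glue x y))
        (apPinch a b (glue a y)) (apPinch a b (glue a b)))) :=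
  Lam fun A => Lam fun a => Lam fun B => Lam fun b => Lam fun x => Lam fun y =>
    (apZigzag (pinchEl a b) (glue a b) (glue x b) (glue x y) (glue a y) (glue a b)).cast

def apPinchZigzag {A B : Exp} (a : El A) (b : El B) (x : El A) (y : El B) :
    El (Id (apPinch a b (detour a b x y))
      (zigzag (apPinch a b (glue a b)) (apPinch a b (glue x b)) (apPinch a b (glue x y))
        (apPinch a b (glue a y)) (apPinch a b (glue a b)))) :=
  ⟨ref .apPinchZigzag A a B b x y⟩

/-- The outer factors of the image are meridians of points on the axes, hence equal to the meridian
of the base point; they cancel and the middle one survives. -/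
def apPinchDetourDef : El (Pi (U 0) fun A => Pi A fun a => Pi (U 0) fun B => Pi B fun b =>
    Pi A fun x => Pi B fun y => Id (apPinch a b (detour a b x y)) (meridEl (smashPair a b x y))) :=
  Lam fun A => Lam fun a => Lam fun B => Lam fun b => Lam fun x => Lam fun y =>
    apPinchZigzag a b x y ⬝
      (zigzagContract (meridL a b a) (meridL a b x) (meridR a b y) (apPinch a b (glue x y)) ⬝
        pinchGlue a b x y)

def meridDefs : List Def :=
  [meridLDef.transparent, meridRDef.transparent, meridLRDef.sealed, apPinchZigzagDef.transparent,
    apPinchDetourDef.transparent]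

def meridCtx : Ctx := retractionCtx.extend 57 meridDefs

theorem realizable_meridCtx : meridCtx.Realizable :=
  realizable_retractionCtx.extend (by decide +kernel)

def apPinchDetour {A B : Exp} (a : El A) (b : El B) (x : El A) (y : El B) :
    El (Id (apPinch a b (detour a b x y)) (meridEl (smashPair a b x y))) :=
  ⟨ref .apPinchDetour A a B b x y⟩

/-- The square over push_l is cut along the contraction of the image zigzag: `apZigzagL` fills one
piece and `contractL` the other. `meridLR` enters because the fourth factor is contracted by
`meridR`, while the value at the base point is `meridL a b a`. -/
def apPinchDetourLDef : El (Pi (U 0) fun A => Pi A fun a => Pi (U 0) fun B => Pi B fun b =>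
    Pi A fun x => Id (cong (fun i => apPinch a b i) (detourL a b x) ⬝ meridL a b a)
      (apPinchDetour a b x b ⬝ cong meridEl (smashPushL a b x))) :=
  Lam fun A => Lam fun a => Lam fun B => Lam fun b => Lam fun x =>
    (paste (p := cong (fun i => apPinch a b i) (detourL a b x)) (d := apPinchZigzag a b x b)
      (l := zigzagL (apPinch a b (glue a b)) (apPinch a b (glue x b)))
      (apZigzagL (pinchEl a b) (glue a b) (glue x b)).cast (w := meridL a b a)
      (e := zigzagContract (meridL a b a) (meridL a b x) (meridR a b b) (apPinch a b (glue x b)))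
      (β := pinchGlue a b x b) (m := cong meridEl (smashPushL a b x))
      (contractL (meridLR a b) (meridL a b x)).cast).cast

def apPinchDetourLDefs : List Def :=
  [apPinchDetourLDef.sealed]

def apPinchDetourLCtx : Ctx := meridCtx.extend 62 apPinchDetourLDefs

theorem realizable_apPinchDetourLCtx : apPinchDetourLCtx.Realizable :=
  realizable_meridCtx.extend (by decide +kernel)

def apPinchDetourL {A B : Exp} (a : El A) (b : El B) (x : El A) :
    El (Id (cong (fun i => apPinch a b i) (detourL a b x) ⬝ meridL a b a)
      (apPinchDetour a b x b ⬝ cong meridEl (smashPushL a b x))) :=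
  ⟨ref .apPinchDetourL A a B b x⟩

/-- The value at the base point is again `meridL a b a`. It contracts the first, second and fifth
factors here, so `contractR` needs no comparison through `meridLR`. -/
def apPinchDetourRDef : El (Pi (U 0) fun A => Pi A fun a => Pi (U 0) fun B => Pi B fun b =>
    Pi B fun y => Id (cong (fun i => apPinch a b i) (detourR a b y) ⬝ meridL a b a)
      (apPinchDetour a b a y ⬝ cong meridEl (smashPushR a b y))) :=
  Lam fun A => Lam fun a => Lam fun B => Lam fun b => Lam fun y =>
    (paste (p := cong (fun i => apPinch a b i) (detourR a b y)) (d := apPinchZigzag a b a y)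
      (l := zigzagR (apPinch a b (glue a b)) (apPinch a b (glue a y)))
      (apZigzagR (pinchEl a b) (glue a b) (glue a y)).cast (w := meridL a b a)
      (e := zigzagContract (meridL a b a) (meridL a b a) (meridR a b y) (apPinch a b (glue a y)))
      (β := pinchGlue a b a y) (m := cong meridEl (smashPushR a b y))
      (contractR (meridL a b a) (meridR a b y)).cast).cast

def apPinchDetourRDefs : List Def :=
  [apPinchDetourRDef.sealed]

def apPinchDetourRCtx : Ctx := apPinchDetourLCtx.extend 63 apPinchDetourRDefs

theorem realizable_apPinchDetourRCtx : apPinchDetourRCtx.Realizable :=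
  realizable_apPinchDetourLCtx.extend (by decide +kernel)

def apPinchDetourR {A B : Exp} (a : El A) (b : El B) (y : El B) :
    El (Id (cong (fun i => apPinch a b i) (detourR a b y) ⬝ meridL a b a)
      (apPinchDetour a b a y ⬝ cong meridEl (smashPushR a b y))) :=
  ⟨ref .apPinchDetourR A a B b y⟩

def apPinchSmashPathLDef : El (Pi (U 0) fun A => Pi A fun a => Pi (U 0) fun B => Pi B fun b =>
    Pi A fun x => Id (cong (fun i => apPinch a b i) (ap' (smashPath a b) (smashPushL a b x)).cast)
      (cong (fun i => apPinch a b i) (detourL a b x))) :=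
  Lam fun A => Lam fun a => Lam fun B => Lam fun b => Lam fun x =>
    (cong (cong fun i => apPinch a b i) (smashPathL a b x)).cast

def apPinchSmashPathL {A B : Exp} (a : El A) (b : El B) (x : El A) :
    El (Id (cong (fun i => apPinch a b i) (ap' (smashPath a b) (smashPushL a b x)).cast)
      (cong (fun i => apPinch a b i) (detourL a b x))) :=
  ⟨ref .apPinchSmashPathL A a B b x⟩

def apPinchSmashPathRDef : El (Pi (U 0) fun A => Pi A fun a => Pi (U 0) fun B => Pi B fun b =>
    Pi B fun y => Id (cong (fun i => apPinch a b i) (ap' (smashPath a b) (smashPushR a b y)).cast)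
      (cong (fun i => apPinch a b i) (detourR a b y))) :=
  Lam fun A => Lam fun a => Lam fun B => Lam fun b => Lam fun y =>
    (cong (cong fun i => apPinch a b i) (smashPathR a b y)).cast

def apPinchSmashPathDefs : List Def :=
  [apPinchSmashPathLDef.sealed, apPinchSmashPathRDef.sealed]

def apPinchSmashPathCtx : Ctx := apPinchDetourRCtx.extend 64 apPinchSmashPathDefs

theorem realizable_apPinchSmashPathCtx : apPinchSmashPathCtx.Realizable :=
  realizable_apPinchDetourRCtx.extend (by decide +kernel)

def apPinchSmashPathR {A B : Exp} (a : El A) (b : El B) (y : El B) :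
    El (Id (cong (fun i => apPinch a b i) (ap' (smashPath a b) (smashPushR a b y)).cast)
      (cong (fun i => apPinch a b i) (detourR a b y))) :=
  ⟨ref .apPinchSmashPathR A a B b y⟩

/-! ### Dependent paths over push_l and push_r, and the second homotopy. -/

def apPinchOverLDef : El (Pi (U 0) fun A => Pi A fun a => Pi (U 0) fun B => Pi B fun b =>
    Pi A fun x => Over (ApPinchPath a b) (smashPushL a b x)
      (apPinchDetour a b x b).cast (meridL a b a).cast) :=
  Lam fun A => Lam fun a => Lam fun B => Lam fun b => Lam fun x =>
    (overSquare (smashPath a b) (Lam fun p => apPinch a b p) (Lam fun s => meridEl s)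
      (smashPushL a b x) (u := (apPinchDetour a b x b).cast) (v := (meridL a b a).cast)
      (cong (fun i => i ⬝ meridL a b a) (apPinchSmashPathL a b x) ⬝
        apPinchDetourL a b x).cast).cast

def apPinchOverLDefs : List Def :=
  [apPinchOverLDef.sealed]

def apPinchOverLCtx : Ctx := apPinchSmashPathCtx.extend 66 apPinchOverLDefs

theorem realizable_apPinchOverLCtx : apPinchOverLCtx.Realizable :=
  realizable_apPinchSmashPathCtx.extend (by decide +kernel)

def apPinchOverL {A B : Exp} (a : El A) (b : El B) (x : El A) :
    El (Over (ApPinchPath a b) (smashPushL a b x)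
      (apPinchDetour a b x b).cast (meridL a b a).cast) :=
  ⟨ref .apPinchOverL A a B b x⟩

def apPinchOverRDef : El (Pi (U 0) fun A => Pi A fun a => Pi (U 0) fun B => Pi B fun b =>
    Pi B fun y => Over (ApPinchPath a b) (smashPushR a b y)
      (apPinchDetour a b a y).cast (meridL a b a).cast) :=
  Lam fun A => Lam fun a => Lam fun B => Lam fun b => Lam fun y =>
    (overSquare (smashPath a b) (Lam fun p => apPinch a b p) (Lam fun s => meridEl s)
      (smashPushR a b y) (u := (apPinchDetour a b a y).cast) (v := (meridL a b a).cast)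
      (cong (fun i => i ⬝ meridL a b a) (apPinchSmashPathR a b y) ⬝
        apPinchDetourR a b y).cast).cast

def apPinchOverRDefs : List Def :=
  [apPinchOverRDef.sealed]

def apPinchOverRCtx : Ctx := apPinchOverLCtx.extend 67 apPinchOverRDefs

theorem realizable_apPinchOverRCtx : apPinchOverRCtx.Realizable :=
  realizable_apPinchOverLCtx.extend (by decide +kernel)

def apPinchOverR {A B : Exp} (a : El A) (b : El B) (y : El B) :
    El (Over (ApPinchPath a b) (smashPushR a b y)
      (apPinchDetour a b a y).cast (meridL a b a).cast) :=
  ⟨ref .apPinchOverR A a B b y⟩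

/-- Only the existence of the identification for each `s` matters, so its sides over push_l and
push_r need not be shown to agree over push_lr. -/
def apPinchPathDef : El (Pi (U 0) fun A => Pi A fun a => Pi (U 0) fun B => Pi B fun b =>
    Pi (Smash a b) fun s => ApPinchPath a b s) :=
  Lam fun A => Lam fun a => Lam fun B => Lam fun b =>
    smashIndWeak (ApPinchPath a b) (meridL a b a).cast (fun x y => (apPinchDetour a b x y).cast)
      (fun x => (apPinchOverL a b x).cast) (fun y => (apPinchOverR a b y).cast)

def apPinchPath {A B : Exp} (a : El A) (b : El B) :
    El (Pi (Smash a b) fun s => ApPinchPath a b s) :=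
  ⟨ref .apPinchPath A a B b⟩

def sectMeridDef : El (Pi (U 0) fun A => Pi A fun a => Pi (U 0) fun B => Pi B fun b =>
    Pi (Smash a b) fun s =>
    Id (apPinch a b (apUnpinch a b (meridEl s)) ⬝ rfl') (rfl' ⬝ meridEl s)) :=
  Lam fun A => Lam fun a => Lam fun B => Lam fun b => Lam fun s =>
    (cong (fun i => apPinch a b i) (unpinchMerid a b s) ⬝ apPinchPath a b s ⬝
      inv (leftUnit (meridEl s))).cast

def sectMerid {A B : Exp} (a : El A) (b : El B) (s : El (Smash a b)) :
    El (Id (apPinch a b (apUnpinch a b (meridEl s)) ⬝ rfl') (rfl' ⬝ meridEl s)) :=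
  ⟨ref .sectMerid A a B b s⟩

/-- Both maps compute on the point constructors and fix the poles, so `refl` serves there and all
content lies over the meridians. -/
def sectDef : El (Pi (U 0) fun A => Pi A fun a => Pi (U 0) fun B => Pi B fun b =>
    Pi (SuspSmash a b) fun y => Id (pinchEl a b (unpinch a b y)) y) :=
  Lam fun A => Lam fun a => Lam fun B => Lam fun b =>
    ⟨cst (.suspInd 0 0) (Smash a b)
      (lam (SuspSmash a b) fun y => idt 0 (SuspSmash a b) (pinchEl a b (unpinch a b ⟨y⟩)) y)
      (refl 0 (SuspSmash a b) (northEl : El (SuspSmash a b)))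
      (refl 0 (SuspSmash a b) (southEl : El (SuspSmash a b)))
      (Lam fun s : El (Smash a b) =>
        overRetract (unpinch a b) (pinchEl a b) (meridEl s) (u := rfl') (v := rfl')
          (sectMerid a b s).cast)⟩

def sectDefs : List Def :=
  [apPinchPathDef.sealed, sectMeridDef.sealed, sectDef.sealed]

def sectCtx : Ctx := apPinchOverRCtx.extend 68 sectDefs

theorem realizable_sectCtx : sectCtx.Realizable :=
  realizable_apPinchOverRCtx.extend (by decide +kernel)

def sect {A B : Exp} (a : El A) (b : El B) :
    El (Pi (SuspSmash a b) fun y => Id (pinchEl a b (unpinch a b y)) y) :=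
  ⟨ref .sect A a B b⟩

/-- The statement that the pinch map is an equivalence. -/
def pinchIsEquiv (i : ℕ) : Exp :=
  HoTT.pi (HoTT.U i) fun A => HoTT.pi A fun a => HoTT.pi (HoTT.U i) fun B => HoTT.pi B fun b =>
    HoTT.isEquiv i (HoTT.join i A B) (HoTT.susp i (HoTT.smash i A a B b)) (HoTT.pinch i A a B b)

/-- `Join` and `pinchEl` refer to transparent definitions of the context; the cast unfolds them to
the closed terms of the statement. -/
def pinchIsEquivDef : El (pinchIsEquiv 0) :=
  El.cast (T := Pi (U 0) fun A => Pi A fun a => Pi (U 0) fun B => Pi B fun b =>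
      Pi (SuspSmash a b) fun y => isContr 0 (Fib (pinchEl a b) y))
    (Lam fun A => Lam fun a => Lam fun B => Lam fun b =>
      quasiInverse (pinchEl a b) (unpinch a b) (retraction a b) (sect a b))

def pinchIsEquivDefs : List Def :=
  [pinchIsEquivDef.sealed]

def pinchIsEquivCtx : Ctx := sectCtx.extend 71 pinchIsEquivDefs

theorem realizable_pinchIsEquivCtx : pinchIsEquivCtx.Realizable :=
  realizable_sectCtx.extend (by decide +kernel)

/-! ### The pinch map is an equivalence -/

theorem Holds.lift {A A' : Exp} (h : Holds A) (i : ℕ) (hA : A.close.lift i = A'.close) :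
    Holds A' := by
  obtain ⟨t, ht⟩ := h
  exact ⟨t.lift i, hA ▸ ht.lift i⟩

/-- The statement is the type of the latest entry of a realizable context, so variable `0` is
realized by a term of that type in the empty context. The type is closed, hence unaffected by the
realizing substitution. -/
theorem holds_pinchIsEquiv_zero : Holds (pinchIsEquiv 0) := by
  obtain ⟨s, hs⟩ := realizable_pinchIsEquivCtx
  have h := (hs.type 0 _ _ rfl).1
  -- `71` is the number of earlier definitions. The type mentions none of them, so neither this
  -- depth nor the shift changes its term.
  have e : Tm.same (Tm.shift 1 0 (pinchIsEquivDef.sealed.type.toTm 71)) (pinchIsEquiv 0).close =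
      true := by
    decide +kernel
  have hc : (pinchIsEquiv 0).close.closedAt 0 = true := by decide +kernel
  rw [Tm.eq_of_same e, Tm.subst_of_closedAt hc (by simp)] at h
  exact ⟨_, h⟩

/-- Every level in the statement at `0` is shifted to `i + 0`, which is `i` by definition. -/
theorem holds_pinchIsEquiv (i : ℕ) : Holds (pinchIsEquiv i) :=
  holds_pinchIsEquiv_zero.lift i rfl

end HoTT

/-- In homotopy type theory, for all types `A` and `B` (of an arbitrary universe `U i`) with base
points `a : A` and `b : B`, the map `pinch : A * B → Susp (A ∧ B)` is an equivalence. -/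
theorem proposition6p3 (i : ℕ) :
    HoTT.Holds
      (HoTT.pi (HoTT.U i) fun A => HoTT.pi A fun a =>
        HoTT.pi (HoTT.U i) fun B => HoTT.pi B fun b =>
          HoTT.isEquiv i (HoTT.join i A B) (HoTT.susp i (HoTT.smash i A a B b))
            (HoTT.pinch i A a B b)) :=
  HoTT.holds_pinchIsEquiv i
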